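/- A finite connected undirected simple graph $G=(V,E)$ with distance function $d$ and intervals $I(x,y)=\{z\in V: d(x,z)+d(z,y)=d(x,y)\}$ is called *median* if $I(x,y)\cap I(y,z)\cap I(z,x)$ is a singleton for all $x,y,z\in V$. For a weight function $w:V\to\mathbb{R}_{\ge 0}$ put $w(S)=\sum_{x\in S}w(x)$ for $S\subseteq V$, $w(G)=w(V)$, $F_w(x)=\sum_{v\in V}w(v)\,d(x,v)$, and let $\mathrm{Med}_w(G)$ be the set of all vertices minimizing $F_w$. For $H\subseteq V$, a vertex $u\in H$ is the gate of $x\in V$ in $H$ if $u\in I(z,x)$ for all $z\in H$; the fiber $P_H(u)$ is the set of all $x\in V$ whose gate in $H$ is $u$, and it is positive if $w(P_H(u))>0$. (1) There is an algorithm that, given a median graph $G$ with $n$ vertices and $m$ edges by its adjacency lists (in any order), and a weight function $w$ on $G$ with $w(G)>0$, finds in time $O(m+1)$ (that is, $O(m)$ as soon as $m\ge 1$) two vertices $u,v$ with $$\mathrm{Med}_w(G)=I(u,v);$$ moreover, $u$ is a vertex of $M=\mathrm{Med}_w(G)$ with a positive fiber $P_M(u)$, and $v$ is a vertex of $M$ at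 maximum distance from $u$ among the vertices of $M$. The model of computation is a random access machine with words of $O(\log n)$ bits for $n\ge 2$ (and of bounded length for $n=1$), on which words can be added, subtracted (with negative results replaced by $0$), multiplied and compared, and real weights can be added, subtracted and compared, in unit time; apart from the input, its memory is not initialized. (2) If $G$ is a median graph, $w$ a weight function on $G$, $M=\mathrm{Med}_w(G)$, $u\in M$ has a positive fiber $P_M(u)$, and $v\in M$ is at maximum distance from $u$ among the vertices of $M$, then $M=I(u,v)$. -/

import Mathlib

namespace MedianGraph

section Graphs

variable {V : Type*}

/-- The interval `I(u,v)`: all vertices on shortest `(u,v)`-paths (the graphs below are connected). -/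
def interval (G : SimpleGraph V) (u v : V) : Set V :=
  {x | G.dist u x + G.dist x v = G.dist u v}

/-- A median graph: connected, and any three vertices have exactly one common median. -/
def IsMedian (G : SimpleGraph V) : Prop :=
  G.Connected ∧
    ∀ x y z : V, ∃ c : V, interval G x y ∩ interval G y z ∩ interval G z x = {c}

/-- The median function `F_w(x) = ∑ v, w(v) d(x,v)`. -/
noncomputable def medianFn [Fintype V] (G : SimpleGraph V) (w : V → ℝ) (x : V) : ℝ :=
  ∑ v, w v * (G.dist x v : ℝ)

/-- The median set `Med_w(G)`: all minimizers of the median function. -/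
def medianSet [Fintype V] (G : SimpleGraph V) (w : V → ℝ) : Set V :=
  {x | ∀ y, medianFn G w x ≤ medianFn G w y}

/-- `g` is the gate of `x` in `H`. -/
def IsGate (G : SimpleGraph V) (H : Set V) (x g : V) : Prop :=
  g ∈ H ∧ ∀ z ∈ H, g ∈ interval G z x

/-- The fiber `P_H(u)`: all vertices whose gate in `H` is `u`. -/
def fiber (G : SimpleGraph V) (H : Set V) (u : V) : Set V :=
  {x | IsGate G H x u}

open Classical in
/-- The weight `w(S)` of a set of vertices. -/
noncomputable def weight [Fintype V] (w : V → ℝ) (S : Set V) : ℝ :=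
  ∑ v, if v ∈ S then w v else 0

/-- `v` is a vertex of `H` at maximum distance from `u` among the vertices of `H`. -/
def IsFarthest (G : SimpleGraph V) (H : Set V) (u v : V) : Prop :=
  v ∈ H ∧ ∀ z ∈ H, G.dist u z ≤ G.dist u v

end Graphs

/-! ### The machine

A random access machine with two sorts of data: natural numbers of bounded size ("words", used
also as addresses) and real numbers (the weights). Words can be added, subtracted (truncated at
zero), multiplied and compared; reals can be added, subtracted and compared, and there is no
conversion between the two sorts. Memory consists of variables and arrays of either sort, each
named by a numeral in the text of the program; a program is a finite piece of syntax, so it uses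
only finitely many of them. Every evaluated node of an expression and every executed command
costs one unit of time. -/

/-- The contents of the memory. -/
structure State where
  /-- word variables -/
  word : ℕ → ℕ
  /-- real variables -/
  real : ℕ → ℝ
  /-- word arrays: name, then index -/
  wordArr : ℕ → ℕ → ℕ
  /-- real arrays: name, then index -/
  realArr : ℕ → ℕ → ℝ

namespace State

def setWord (s : State) (x k : ℕ) : State :=
  { s with word := Function.update s.word x k }

noncomputable def setReal (s : State) (x : ℕ) (r : ℝ) : State :=
  { s with real := Function.update s.real x r }

def setWordArr (s : State) (a i k : ℕ) : State :=
  { s with wordArr := Function.update s.wordArr a (Function.update (s.wordArr a) i k) }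

noncomputable def setRealArr (s : State) (a i : ℕ) (r : ℝ) : State :=
  { s with realArr := Function.update s.realArr a (Function.update (s.realArr a) i r) }

end State

/-- Word expressions. -/
inductive WExp where
  | const (k : ℕ)
  | var (x : ℕ)
  | get (a : ℕ) (i : WExp)
  | add (e f : WExp)
  | sub (e f : WExp)
  | mul (e f : WExp)

namespace WExp

def eval (s : State) : WExp → ℕ
  | const k => k
  | var x => s.word x
  | get a i => s.wordArr a (i.eval s)
  | add e f => e.eval s + f.eval s
  | sub e f => e.eval s - f.eval s
  | mul e f => e.eval s * f.eval s

def cost : WExp → ℕ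
  | const _ => 1
  | var _ => 1
  | get _ i => i.cost + 1
  | add e f => e.cost + f.cost + 1
  | sub e f => e.cost + f.cost + 1
  | mul e f => e.cost + f.cost + 1

/-- No overflow: every value met while evaluating the expression is at most `B`. -/
def Fits (B : ℕ) (s : State) : WExp → Prop
  | const k => k ≤ B
  | var x => s.word x ≤ B
  | get a i => i.Fits B s ∧ s.wordArr a (i.eval s) ≤ B
  | add e f => e.Fits B s ∧ f.Fits B s ∧ e.eval s + f.eval s ≤ B
  | sub e f => e.Fits B s ∧ f.Fits B s
  | mul e f => e.Fits B s ∧ f.Fits B s ∧ e.eval s * f.eval s ≤ B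

end WExp

/-- Real expressions. -/
inductive RExp where
  | zero
  | var (x : ℕ)
  | get (a : ℕ) (i : WExp)
  | add (e f : RExp)
  | sub (e f : RExp)

namespace RExp

noncomputable def eval (s : State) : RExp → ℝ
  | zero => 0
  | var x => s.real x
  | get a i => s.realArr a (i.eval s)
  | add e f => e.eval s + f.eval s
  | sub e f => e.eval s - f.eval s

def cost : RExp → ℕ
  | zero => 1
  | var _ => 1
  | get _ i => i.cost + 1
  | add e f => e.cost + f.cost + 1
  | sub e f => e.cost + f.cost + 1

/-- No overflow in the array indices. -/
def Fits (B : ℕ) (s : State) : RExp → Prop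
  | zero => True
  | var _ => True
  | get _ i => i.Fits B s
  | add e f => e.Fits B s ∧ f.Fits B s
  | sub e f => e.Fits B s ∧ f.Fits B s

end RExp

/-- Tests. -/
inductive Test where
  | wordLt (e f : WExp)
  | wordEq (e f : WExp)
  | realLt (e f : RExp)
  | neg (b : Test)
  | conj (b c : Test)

namespace Test

def Holds (s : State) : Test → Prop
  | wordLt e f => e.eval s < f.eval s
  | wordEq e f => e.eval s = f.eval s
  | realLt e f => e.eval s < f.eval s
  | neg b => ¬ b.Holds s
  | conj b c => b.Holds s ∧ c.Holds s

def cost : Test → ℕ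
  | wordLt e f => e.cost + f.cost + 1
  | wordEq e f => e.cost + f.cost + 1
  | realLt e f => e.cost + f.cost + 1
  | neg b => b.cost + 1
  | conj b c => b.cost + c.cost + 1

def Fits (B : ℕ) (s : State) : Test → Prop
  | wordLt e f => e.Fits B s ∧ f.Fits B s
  | wordEq e f => e.Fits B s ∧ f.Fits B s
  | realLt e f => e.Fits B s ∧ f.Fits B s
  | neg b => b.Fits B s
  | conj b c => b.Fits B s ∧ c.Fits B s

end Test

/-- Programs. -/
inductive Prog where
  | skip
  | setWord (x : ℕ) (e : WExp)
  | setReal (x : ℕ) (e : RExp)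
  | putWord (a : ℕ) (i e : WExp)
  | putReal (a : ℕ) (i : WExp) (e : RExp)
  | seq (p q : Prog)
  | branch (b : Test) (p q : Prog)
  | loop (b : Test) (p : Prog)

/-- `Exec B p s t s'`: on a machine whose words are at most `B`, the program `p`, started in the
memory state `s`, halts after exactly `t` steps in the state `s'`, without overflow. -/
inductive Exec (B : ℕ) : Prog → State → ℕ → State → Prop
  | skip (s : State) : Exec B Prog.skip s 1 s
  | setWord (x : ℕ) (e : WExp) (s : State) : e.Fits B s →
      Exec B (Prog.setWord x e) s (e.cost + 1) (s.setWord x (e.eval s))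
  | setReal (x : ℕ) (e : RExp) (s : State) : e.Fits B s →
      Exec B (Prog.setReal x e) s (e.cost + 1) (s.setReal x (e.eval s))
  | putWord (a : ℕ) (i e : WExp) (s : State) : i.Fits B s → e.Fits B s →
      Exec B (Prog.putWord a i e) s (i.cost + e.cost + 1)
        (s.setWordArr a (i.eval s) (e.eval s))
  | putReal (a : ℕ) (i : WExp) (e : RExp) (s : State) : i.Fits B s → e.Fits B s →
      Exec B (Prog.putReal a i e) s (i.cost + e.cost + 1)
        (s.setRealArr a (i.eval s) (e.eval s))
  | seq (p q : Prog) (s s' s'' : State) (t t' : ℕ) :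
      Exec B p s t s' → Exec B q s' t' s'' →
      Exec B (Prog.seq p q) s (t + t') s''
  | branch_true (b : Test) (p q : Prog) (s s' : State) (t : ℕ) :
      b.Fits B s → b.Holds s → Exec B p s t s' →
      Exec B (Prog.branch b p q) s (b.cost + 1 + t) s'
  | branch_false (b : Test) (p q : Prog) (s s' : State) (t : ℕ) :
      b.Fits B s → ¬ b.Holds s → Exec B q s t s' →
      Exec B (Prog.branch b p q) s (b.cost + 1 + t) s'
  | loop_true (b : Test) (p : Prog) (s s' s'' : State) (t t' : ℕ) :
      b.Fits B s → b.Holds s → Exec B p s t s' → Exec B (Prog.loop b p) s' t' s'' →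
      Exec B (Prog.loop b p) s (b.cost + 1 + t + t') s''
  | loop_false (b : Test) (p : Prog) (s : State) :
      b.Fits B s → ¬ b.Holds s →
      Exec B (Prog.loop b p) s (b.cost + 1) s

/-- The state `s` holds the weighted graph `(G, w)` with vertices `0, …, n - 1`, given by its
adjacency lists (in any order): the number of vertices is in word variable `0`; the neighbours of
`v` are listed, each once, in word array `1` between the positions `off v` (included) and
`off (v + 1)` (excluded), where `off` is word array `0`; the weights are in real array `0`.
The rest of the memory is not initialized, that is, arbitrary. -/
structure HoldsInput {n : ℕ} (G : SimpleGraph (Fin n)) (w : Fin n → ℝ) (s : State) : Prop where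
  size : s.word 0 = n
  off_zero : s.wordArr 0 0 = 0
  off_le : ∀ v : Fin n, s.wordArr 0 v ≤ s.wordArr 0 (v + 1)
  lists : ∀ v : Fin n, Set.BijOn (s.wordArr 1)
    (Set.Ico (s.wordArr 0 v) (s.wordArr 0 (v + 1)))
    ((fun u : Fin n => (u : ℕ)) '' G.neighborSet v)
  weights : ∀ v : Fin n, s.realArr 0 v = w v

end MedianGraph

/-! The proof rests on halfspaces. For an edge `xy` of a median graph, the set W(x,y) of vertices
closer to `x` than to `y` is convex, and every edge leaving it defines the same halfspace
(`half_eq_of_cross`). Moving along the edge changes the median function by F(x) - F(y) = w(V) -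
2w(W(x,y)) (`medianFn_adj`). Hence a halfspace with less than half of the weight misses the median
set M, M is convex, and every edge inside M splits the weight into two equal halves.

Part (2), `medianSet_eq_interval`: let x in M lie outside I(u,v). The first edge from the median c
of u, v, x towards x bounds a halfspace H that contains x but neither u, nor v, nor a positive
vertex z of the fiber of u. Let v' be the next vertex from v towards its gate in H. If v' is in H,
then H = W(v',v), so v' is farther from u than v is. Otherwise W(v',v) contains H and also z, so it
is strictly heavier than H, although both weigh exactly one half.

Part (1): number the vertices by breadth-first search from a root r of positive weight, and label
each halfspace avoiding r by its first vertex. The key fact, `exists_isTop`, is that among the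
halfspaces separating v from r, the one with the largest label is bounded by an edge from v to some
neighbour t closer to r. Every other neighbour of v closer to r has the same largest label, while
that of t is smaller. So the minimum and maximum of the labels below v reveal t and the label of v;
if they agree, v has a single lower neighbour and is itself the first vertex of its halfspace.

With t as the parent of v, the tree path from v to r crosses each halfspace separating them exactly
once. A backward pass that pushes weights to parents therefore yields all halfspace weights
(`IsTree.push_weight`), and a forward pass yields F up to a constant. The first minimizer in the
search order is the gate of r in M, so its fiber is positive; the last one is farthest from r, hence
from that gate. Connectivity gives n ≤ m + 1, so linear passes over vertices and lists cost O(m +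
1). -/

namespace MedianGraph

/-! ### Halfspaces, convexity and gates in median graphs -/

section Theory

variable {V : Type*} {G : SimpleGraph V}

/-- The halfspace `W(x,y)`: all vertices closer to `x` than to `y`. -/
def half (G : SimpleGraph V) (x y : V) : Set V :=
  {z | G.dist z x < G.dist z y}

theorem mem_half {x y z : V} : z ∈ half G x y ↔ G.dist z x < G.dist z y := Iff.rfl

theorem mem_interval {x y z : V} : z ∈ interval G x y ↔ G.dist x z + G.dist z y = G.dist x y :=
  Iff.rfl

theorem interval_comm (x y : V) : interval G x y = interval G y x := by
  ext z
  simp only [mem_interval, G.dist_comm (u := x), G.dist_comm (u := z) (v := y)]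
  omega

theorem exists_adj_toward (hc : G.Connected) {x y : V} (h : x ≠ y) :
    ∃ z, G.Adj x z ∧ G.dist x y = G.dist z y + 1 := by
  obtain ⟨p, hp⟩ := hc.exists_walk_length_eq_dist x y
  cases p with
  | nil => exact absurd rfl h
  | cons hadj q =>
    rename_i z
    refine ⟨z, hadj, ?_⟩
    have h1 := G.dist_le q
    have h2 : G.dist x y ≤ G.dist x z + G.dist z y := hc.dist_triangle
    rw [SimpleGraph.dist_eq_one_iff_adj.2 hadj] at h2
    rw [SimpleGraph.Walk.length_cons] at hp
    omega

namespace IsMedian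

theorem triangle (hG : IsMedian G) (x y z : V) : G.dist x z ≤ G.dist x y + G.dist y z :=
  hG.1.dist_triangle

theorem eq_of_dist (hG : IsMedian G) {x y : V} (h : G.dist x y = 0) : x = y :=
  hG.1.dist_eq_zero_iff.1 h

theorem exists_median (hG : IsMedian G) (x y z : V) :
    ∃ c, c ∈ interval G x y ∧ c ∈ interval G y z ∧ c ∈ interval G z x := by
  obtain ⟨c, hc⟩ := hG.2 x y z
  have : c ∈ interval G x y ∩ interval G y z ∩ interval G z x := by rw [hc]; rfl
  exact ⟨c, this.1.1, this.1.2, this.2⟩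

theorem median_unique (hG : IsMedian G) {x y z c e : V}
    (h1 : c ∈ interval G x y) (h2 : c ∈ interval G y z) (h3 : c ∈ interval G z x)
    (h4 : e ∈ interval G x y) (h5 : e ∈ interval G y z) (h6 : e ∈ interval G z x) : c = e := by
  obtain ⟨a, ha⟩ := hG.2 x y z
  have hc : c ∈ interval G x y ∩ interval G y z ∩ interval G z x := ⟨⟨h1, h2⟩, h3⟩
  have he : e ∈ interval G x y ∩ interval G y z ∩ interval G z x := ⟨⟨h4, h5⟩, h6⟩
  rw [ha] at hc he
  exact hc.trans he.symm

/-- Bipartiteness: the median of `x`, `y`, `z` lies on the edge `xy`, so it is one of its ends. -/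
theorem dist_adj (hG : IsMedian G) {x y : V} (h : G.Adj x y) (z : V) :
    G.dist z y = G.dist z x + 1 ∨ G.dist z x = G.dist z y + 1 := by
  obtain ⟨c, h1, h2, h3⟩ := hG.exists_median x y z
  simp only [mem_interval] at h1 h2 h3
  have hxy := SimpleGraph.dist_eq_one_iff_adj.2 h
  have e1 := G.dist_comm (u := x) (v := c)
  have e2 := G.dist_comm (u := y) (v := c)
  have e3 := G.dist_comm (u := z) (v := c)
  have e4 := G.dist_comm (u := z) (v := y)
  omega

theorem half_compl (hG : IsMedian G) {x y : V} (h : G.Adj x y) (z : V) :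
    z ∉ half G x y ↔ z ∈ half G y x := by
  have := hG.dist_adj h z
  simp only [mem_half]
  omega

theorem half_left (_ : IsMedian G) {x y : V} (h : G.Adj x y) : x ∈ half G x y := by
  simp [mem_half, SimpleGraph.dist_eq_one_iff_adj.2 h]

theorem not_half_right (_ : IsMedian G) {x y : V} : y ∉ half G x y := by
  simp [mem_half]

theorem dist_two (hG : IsMedian G) {x y v : V} (hx : G.Adj x v) (hy : G.Adj v y) (h : x ≠ y) :
    G.dist x y = 2 := by
  have h1 := hG.dist_adj hy x
  have h2 := SimpleGraph.dist_eq_one_iff_adj.2 hx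
  have h3 : G.dist x y ≠ 0 := fun h0 => h (hG.eq_of_dist h0)
  omega

/-- The quadrangle condition. -/
theorem quadrangle (hG : IsMedian G) {r v x y : V} (hx : G.Adj v x) (hy : G.Adj v y) (hxy : x ≠ y)
    (dx : G.dist r v = G.dist r x + 1) (dy : G.dist r v = G.dist r y + 1) :
    ∃ t, G.Adj x t ∧ G.Adj y t ∧ G.dist r x = G.dist r t + 1 := by
  obtain ⟨t, h1, h2, h3⟩ := hG.exists_median x y r
  simp only [mem_interval] at h1 h2 h3
  have h4 := hG.dist_two hx.symm hy hxy
  have e1 := G.dist_comm (u := x) (v := t)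
  have e2 := G.dist_comm (u := y) (v := t)
  have e3 := G.dist_comm (u := r) (v := t)
  have e4 := G.dist_comm (u := r) (v := y)
  refine ⟨t, SimpleGraph.dist_eq_one_iff_adj.1 ?_, SimpleGraph.dist_eq_one_iff_adj.1 ?_, ?_⟩ <;>
  omega

/-- Opposite edges of a square are parallel: if some `z` were closer to `x` than to `y` but closer
to `y'` than to `x'`, then `x` and `y'` would both be medians of `y`, `x'`, `z`. -/
theorem half_square (hG : IsMedian G) {x y x' y' : V} (hxy : G.Adj x y) (hx : G.Adj x x')
    (hy : G.Adj y y') (hxy' : G.Adj x' y') (h1 : x ≠ y') (h2 : y ≠ x') :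
    half G x y = half G x' y' := by
  have key : ∀ {x y x' y' : V}, G.Adj x y → G.Adj x x' → G.Adj y y' → G.Adj x' y' →
      x ≠ y' → y ≠ x' → ∀ z, G.dist z x < G.dist z y → G.dist z x' < G.dist z y' := by
    intro x y x' y' hxy hx hy hxy' h1 h2 z hz
    by_contra hcon
    have a1 := hG.dist_adj hxy z
    have a2 := hG.dist_adj hx z
    have a3 := hG.dist_adj hy z
    have a4 := hG.dist_adj hxy' z
    have b1 := hG.dist_two hxy.symm hx h2
    have b2 := SimpleGraph.dist_eq_one_iff_adj.2 hxy
    have b3 := SimpleGraph.dist_eq_one_iff_adj.2 hx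
    have b4 := SimpleGraph.dist_eq_one_iff_adj.2 hy
    have b5 := SimpleGraph.dist_eq_one_iff_adj.2 hxy'
    have e1 := G.dist_comm (u := x) (v := y)
    have e2 := G.dist_comm (u := x') (v := y')
    have e3 := G.dist_comm (u := x') (v := z)
    have e4 := G.dist_comm (u := x) (v := z)
    have e5 := G.dist_comm (u := y') (v := z)
    have e6 := G.dist_comm (u := y) (v := z)
    have e7 := G.dist_comm (u := x') (v := x)
    have e8 := G.dist_comm (u := y') (v := y)
    refine h1 (hG.median_unique (x := y) (y := x') (z := z) ?_ ?_ ?_ ?_ ?_ ?_) <;>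
    simp only [mem_interval] <;> omega
  ext z
  exact ⟨key hxy hx hy hxy' h1 h2 z, key hxy' hx.symm hy.symm hxy h2.symm h1.symm z⟩

/-- An edge between a halfspace and its complement defines the same halfspace. -/
theorem half_eq_of_cross (hG : IsMedian G) {v u x y : V} (hvu : G.Adj v u) (hxy : G.Adj x y)
    (hx : x ∈ half G v u) (hy : y ∉ half G v u) : half G x y = half G v u := by
  induction hk : G.dist x v generalizing v u with
  | zero =>
    have hxv := hG.eq_of_dist hk
    subst hxv
    have a1 := hG.dist_adj hvu y
    have b := SimpleGraph.dist_eq_one_iff_adj.2 hxy.symm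
    simp only [mem_half] at hy
    rw [hG.eq_of_dist (show G.dist y u = 0 by omega)]
  | succ k ih =>
    have hne : v ≠ x := by rintro rfl; simp at hk
    obtain ⟨v', hv', hd⟩ := exists_adj_toward hG.1 hne
    have a1 := hG.dist_adj hvu x
    have a2 := hG.dist_adj hvu y
    have a3 := hG.dist_adj hv' y
    have a4 := hG.dist_adj hxy v
    have a5 := hG.dist_adj hxy u
    have a6 := hG.dist_adj hxy v'
    have c1 := G.dist_comm (u := x) (v := v)
    have c2 := G.dist_comm (u := y) (v := v)
    have c3 := G.dist_comm (u := x) (v := u)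
    have c4 := G.dist_comm (u := y) (v := u)
    have c5 := G.dist_comm (u := x) (v := v')
    have c6 := G.dist_comm (u := y) (v := v')
    simp only [mem_half] at hx hy
    have hne' : u ≠ v' := by rintro rfl; omega
    -- Both `u` and `v'` are neighbours of `v` closer to `y`. Completing the square replaces the
    -- edge `vu` by the parallel edge `v'u'`, one step nearer to `x`.
    obtain ⟨u', hu1, hu2, hu3⟩ := hG.quadrangle (r := y) hvu hv' hne' (by omega) (by omega)
    have a7 := hG.dist_adj hu1 y
    have hvu' : v ≠ u' := by rintro rfl; omega
    have e := hG.half_square hvu hv' hu1 hu2 hvu' hne'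
    rw [e]
    refine ih hu2 ?_ ?_ (by omega)
    · rw [← e]; exact hx
    · rw [← e]; exact hy

/-- Walk from `x` towards `z`. If a step to `x'` left the halfspace, the halfspace would be W(x,x'),
which cannot contain `y` because `x'` lies between `x` and `y`. -/
theorem half_convex (hG : IsMedian G) {v u x y z : V} (hvu : G.Adj v u)
    (hx : x ∈ half G v u) (hy : y ∈ half G v u) (hz : z ∈ interval G x y) : z ∈ half G v u := by
  induction hk : G.dist x z generalizing x with
  | zero => rwa [← hG.eq_of_dist hk]
  | succ k ih =>
    have hne : x ≠ z := by rintro rfl; simp at hk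
    obtain ⟨x', hx', hd⟩ := exists_adj_toward hG.1 hne
    have h1 := hG.triangle x' z y
    have h2 := hG.triangle x x' y
    have h3 := SimpleGraph.dist_eq_one_iff_adj.2 hx'
    simp only [mem_interval] at hz ih
    have c1 := G.dist_comm (u := x) (v := y)
    have c2 := G.dist_comm (u := x') (v := y)
    refine ih (x := x') ?_ (by omega) (by omega)
    by_contra hcon
    have e := hG.half_eq_of_cross hvu hx' hx hcon
    rw [← e, mem_half] at hy
    omega

/-- The gate is a vertex `g` of `H` nearest to `x`: the median of `z`, `g`, `x` is in `H` by
convexity and cannot be nearer to `x`, so it equals `g`. -/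
theorem exists_isGate (hG : IsMedian G) {H : Set V} (hH : H.Nonempty)
    (hconv : ∀ x ∈ H, ∀ y ∈ H, interval G x y ⊆ H) (x : V) : ∃ g, IsGate G H x g := by
  classical
  have hex : ∃ k, ∃ g ∈ H, G.dist g x = k := by
    obtain ⟨g, hg⟩ := hH
    exact ⟨_, g, hg, rfl⟩
  obtain ⟨g, hg, hgk⟩ := Nat.find_spec hex
  refine ⟨g, hg, fun z hz => ?_⟩
  obtain ⟨c, h1, h2, h3⟩ := hG.exists_median z g x
  have hcH := hconv z hz g hg h1
  have hmin := Nat.find_min' hex ⟨c, hcH, rfl⟩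
  have : c = g := by
    simp only [mem_interval] at h2
    exact (hG.eq_of_dist (by omega)).symm
  rw [interval_comm]
  exact this ▸ h3

/-- A nearest vertex of a convex set is a gate. -/
theorem isGate_of_nearest (hG : IsMedian G) {H : Set V}
    (hconv : ∀ x ∈ H, ∀ y ∈ H, interval G x y ⊆ H) {x g : V} (hg : g ∈ H)
    (hmin : ∀ z ∈ H, G.dist x g ≤ G.dist x z) : IsGate G H x g := by
  obtain ⟨p, hp, hp'⟩ := hG.exists_isGate ⟨g, hg⟩ hconv x
  have h1 := hp' g hg
  have h2 := hmin p hp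
  simp only [mem_interval] at h1
  have c1 := G.dist_comm (u := x) (v := g)
  have c2 := G.dist_comm (u := x) (v := p)
  have : g = p := hG.eq_of_dist (by omega)
  exact this ▸ ⟨hp, hp'⟩

theorem exists_isGate_half (hG : IsMedian G) {a b : V} (hab : G.Adj a b) (x : V) :
    ∃ g, IsGate G (half G a b) x g :=
  hG.exists_isGate ⟨a, hG.half_left hab⟩
    (fun _ hx _ hy _ hz => hG.half_convex hab hx hy hz) x

end IsMedian

/-! ### The median function, convexity of the median set, and part (2) -/

section Weighted

variable [Fintype V] {w : V → ℝ}

/-- By bipartiteness the two distances from each vertex differ by exactly one, with the sign given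
by the halfspace containing that vertex. -/
theorem medianFn_adj (hG : IsMedian G) {x y : V} (h : G.Adj x y) :
    medianFn G w x - medianFn G w y = ∑ z, w z - 2 * weight w (half G x y) := by
  classical
  rw [medianFn, medianFn, weight, Finset.mul_sum, ← Finset.sum_sub_distrib,
    ← Finset.sum_sub_distrib]
  refine Finset.sum_congr rfl fun z _ => ?_
  have a := hG.dist_adj h z
  rw [G.dist_comm (u := x), G.dist_comm (u := y)]
  by_cases hz : z ∈ half G x y
  · rw [if_pos hz]
    rw [mem_half] at hz
    have : G.dist z y = G.dist z x + 1 := by omega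
    rw [this]; push_cast; ring
  · rw [if_neg hz]
    rw [mem_half] at hz
    have : G.dist z x = G.dist z y + 1 := by omega
    rw [this]; push_cast; ring

theorem weight_mono (hw : ∀ x, 0 ≤ w x) {S T : Set V} (h : S ⊆ T) : weight w S ≤ weight w T := by
  classical
  refine Finset.sum_le_sum fun z _ => ?_
  by_cases hS : z ∈ S
  · rw [if_pos hS, if_pos (h hS)]
  · rw [if_neg hS]; split_ifs
    · exact hw z
    · exact le_rfl

theorem weight_half_add (hG : IsMedian G) {x y : V} (h : G.Adj x y) :
    weight w (half G x y) + weight w (half G y x) = ∑ z, w z := by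
  have h1 := medianFn_adj (w := w) hG h
  have h2 := medianFn_adj (w := w) hG h.symm
  linarith

/-- A halfspace with less than half of the weight contains no median vertex. -/
theorem notMem_medianSet_of_minority (hG : IsMedian G) (hw : ∀ x, 0 ≤ w x) {a b z : V}
    (hab : G.Adj a b) (hlt : 2 * weight w (half G a b) < ∑ x, w x) (hz : z ∈ half G a b) :
    z ∉ medianSet G w := by
  obtain ⟨p, hp, hp'⟩ := hG.exists_isGate_half hab.symm z
  induction hk : G.dist z p generalizing z with
  | zero =>
    rw [hG.eq_of_dist hk] at hz
    exact absurd hz ((hG.half_compl hab p).2 hp)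
  | succ k ih =>
    intro hmed
    have hne : z ≠ p := by rintro rfl; simp at hk
    obtain ⟨z', hz', hd⟩ := exists_adj_toward hG.1 hne
    -- Every vertex of the heavy side reaches `z` by a shortest path through the gate `p`, hence
    -- through `z'`. So moving from `z` to `z'` strictly decreases the median function.
    have htoward : half G b a ⊆ half G z' z := by
      intro q hq
      have h1 := hp' q hq
      rw [mem_interval] at h1
      have h2 := hG.triangle q p z'
      have c1 := G.dist_comm (u := p) (v := z)
      have c2 := G.dist_comm (u := p) (v := z')
      rw [mem_half]
      omega
    have hle := weight_mono hw htoward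
    have hadd := weight_half_add (w := w) hG hab
    have hF := medianFn_adj (w := w) hG hz'.symm
    have := hmed z'
    linarith

theorem half_weight_of_medianSet (hG : IsMedian G) (hw : ∀ x, 0 ≤ w x) {a b z : V}
    (hab : G.Adj a b) (hz : z ∈ half G a b) (hm : z ∈ medianSet G w) :
    ∑ x, w x ≤ 2 * weight w (half G a b) := by
  by_contra h
  exact notMem_medianSet_of_minority hG hw hab (not_le.1 h) hz hm

/-- For a step from `x` to `x'` towards `y`, the halfspace W(x',x) contains the median vertex `y`,
so it has at least half of the weight and the step does not increase the median function. -/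
theorem medianSet_convex (hG : IsMedian G) (hw : ∀ x, 0 ≤ w x) {x y z : V}
    (hx : x ∈ medianSet G w) (hy : y ∈ medianSet G w) (hz : z ∈ interval G x y) :
    z ∈ medianSet G w := by
  induction hk : G.dist x z generalizing x with
  | zero => rwa [← hG.eq_of_dist hk]
  | succ k ih =>
    have hne : x ≠ z := by rintro rfl; simp at hk
    obtain ⟨x', hx', hd⟩ := exists_adj_toward hG.1 hne
    have h1 := hG.triangle x' z y
    have h2 := hG.triangle x x' y
    have h3 := SimpleGraph.dist_eq_one_iff_adj.2 hx'
    simp only [mem_interval] at hz ih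
    have c1 := G.dist_comm (u := x) (v := y)
    have c2 := G.dist_comm (u := x') (v := y)
    refine ih (x := x') ?_ (by omega) (by omega)
    have hyh : y ∈ half G x' x := by rw [mem_half]; omega
    have h4 := half_weight_of_medianSet hG hw hx'.symm hyh hy
    have h5 := medianFn_adj (w := w) hG hx'.symm
    intro q
    have := hx q
    linarith

theorem weight_half_eq (hG : IsMedian G) {x y : V} (h : G.Adj x y)
    (hx : x ∈ medianSet G w) (hy : y ∈ medianSet G w) :
    2 * weight w (half G x y) = ∑ z, w z := by
  have h1 := medianFn_adj (w := w) hG h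
  have h2 := hx y
  have h3 := hy x
  linarith

theorem exists_pos_of_weight_pos {S : Set V} (h : 0 < weight w S) :
    ∃ z ∈ S, 0 < w z := by
  classical
  by_contra! hcon
  refine absurd h (not_lt.2 (Finset.sum_nonpos fun z _ => ?_))
  by_cases hz : z ∈ S
  · rw [if_pos hz]; exact hcon z hz
  · rw [if_neg hz]

theorem weight_pos_of_mem (hw : ∀ x, 0 ≤ w x) {S : Set V} {z : V} (hz : z ∈ S) (h : 0 < w z) :
    0 < weight w S := by
  classical
  refine Finset.sum_pos' (fun x _ => ?_) ⟨z, Finset.mem_univ _, by rwa [if_pos hz]⟩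
  split_ifs
  · exact hw x
  · exact le_rfl

theorem medianSet_eq_interval (hG : IsMedian G) (hw : ∀ x, 0 ≤ w x) {u v : V}
    (hu : u ∈ medianSet G w) (hpos : 0 < weight w (fiber G (medianSet G w) u))
    (hfar : IsFarthest G (medianSet G w) u v) : medianSet G w = interval G u v := by
  classical
  obtain ⟨hv, hmax⟩ := hfar
  refine Set.Subset.antisymm (fun x hx => ?_) fun x hx => medianSet_convex hG hw hu hv hx
  obtain ⟨z, ⟨_, hzg⟩, hzpos⟩ := exists_pos_of_weight_pos hpos
  obtain ⟨c, h1, h2, h3⟩ := hG.exists_median u v x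
  by_contra hxI
  have hcM := medianSet_convex hG hw hu hv h1
  have hcx : c ≠ x := by rintro rfl; exact hxI h1
  obtain ⟨x', hx', hd⟩ := exists_adj_toward hG.1 hcx
  have hx'M : x' ∈ medianSet G w := by
    refine medianSet_convex hG hw hcM hx ?_
    have := SimpleGraph.dist_eq_one_iff_adj.2 hx'
    rw [mem_interval]; omega
  have hxH : x ∈ half G x' c := by
    rw [mem_half, G.dist_comm, G.dist_comm (v := c)]; omega
  have hout : ∀ q, c ∈ interval G q x → q ∉ half G x' c := by
    intro q hq
    have := hG.triangle q x' x
    have a := hG.dist_adj hx' q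
    simp only [mem_interval] at hq
    rw [mem_half]; omega
  have huH : u ∉ half G x' c := hout u (by rw [interval_comm]; exact h3)
  have hvH : v ∉ half G x' c := hout v h2
  -- The gate `u` lies between `x'` and `z`, so convexity would force `u` into the halfspace too.
  have hzH : z ∉ half G x' c := fun hz =>
    huH (hG.half_convex hx'.symm (hG.half_left hx'.symm) hz (hzg x' hx'M))
  -- The gate of `v` lies between `x` and `v`, hence in the median set, and so does the step `v'`
  -- towards it.
  obtain ⟨p, hp, hpg⟩ := hG.exists_isGate_half hx'.symm v
  have hpM : p ∈ medianSet G w := medianSet_convex hG hw hx hv (hpg x hxH)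
  have hvp : v ≠ p := by rintro rfl; exact hvH hp
  obtain ⟨v', hv', hdv⟩ := exists_adj_toward hG.1 hvp
  have h4 := SimpleGraph.dist_eq_one_iff_adj.2 hv'
  have hv'M : v' ∈ medianSet G w := by
    refine medianSet_convex hG hw hv hpM ?_
    rw [mem_interval]; omega
  by_cases hv'H : v' ∈ half G x' c
  · have e := hG.half_eq_of_cross hx'.symm hv'.symm hv'H hvH
    rw [← e, mem_half] at huH
    have := hmax v' hv'M
    have a := hG.dist_adj hv' u
    omega
  have hdisj : half G x' c ⊆ half G v' v := by
    intro q hq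
    have h5 := hpg q hq
    rw [mem_interval] at h5
    have h6 := hG.triangle q p v'
    have c1 := G.dist_comm (u := p) (v := v)
    have c2 := G.dist_comm (u := p) (v := v')
    rw [mem_half]
    omega
  -- Maximality of `v` puts `u` on the side of `v'`; since `u` is a gate, `z` lies there as well.
  have huH2 : u ∉ half G v v' := by
    rw [mem_half]
    intro hlt
    have := hmax v' hv'M
    omega
  have hzH2 : z ∉ half G v v' := by
    intro hz
    exact huH2 (hG.half_convex hv' (hG.half_left hv') hz (hzg v hv))
  have w1 := weight_half_eq (w := w) hG hx'.symm hx'M hcM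
  have w2 := weight_half_eq (w := w) hG hv'.symm hv'M hv
  have hlt : weight w (half G x' c) < weight w (half G v' v) := by
    refine Finset.sum_lt_sum (fun q _ => ?_) ⟨z, Finset.mem_univ _, ?_⟩
    · by_cases hq : q ∈ half G x' c
      · rw [if_pos hq, if_pos (hdisj hq)]
      · rw [if_neg hq]
        split_ifs
        · exact hw q
        · exact le_rfl
    · rw [if_neg hzH, if_pos ((hG.half_compl hv' z).1 hzH2)]
      exact hzpos
  linarith

end Weighted

end Theory

/-! ### Labels of halfspaces in a layered order -/

section Labels

variable {V : Type*} {G : SimpleGraph V} {r : V} {pos : V → ℕ}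

/-- `u` is a neighbour of `v` closer to the root `r`. -/
def Down (G : SimpleGraph V) (r v u : V) : Prop :=
  G.Adj v u ∧ G.dist r v = G.dist r u + 1

/-- The halfspaces that avoid the root. -/
def IsUp (G : SimpleGraph V) (r : V) (H : Set V) : Prop :=
  r ∉ H ∧ ∃ a b, G.Adj a b ∧ H = half G a b

/-- The numbering of the vertices refines the distance to the root. -/
structure IsLayered (G : SimpleGraph V) (r : V) (pos : V → ℕ) : Prop where
  inj : Function.Injective pos
  root : pos r = 0
  mono : ∀ x y, G.dist r x < G.dist r y → pos x < pos y

/-- The label of a set of vertices: its least position. -/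
noncomputable def label (pos : V → ℕ) (H : Set V) : ℕ :=
  sInf (pos '' H)

/-- Among the halfspaces that separate `v` from the root, the one across `v u` has the largest
label. -/
def IsTop (G : SimpleGraph V) (r : V) (pos : V → ℕ) (v u : V) : Prop :=
  Down G r v u ∧ ∀ H, IsUp G r H → v ∈ H → label pos H ≤ label pos (half G v u)

theorem label_le {H : Set V} {x : V} (hx : x ∈ H) : label pos H ≤ pos x :=
  Nat.sInf_le ⟨x, hx, rfl⟩

theorem exists_pos_eq_label {H : Set V} (h : H.Nonempty) : ∃ x ∈ H, pos x = label pos H :=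
  Nat.sInf_mem (h.image pos)

theorem exists_down (hG : IsMedian G) {v : V} (hv : v ≠ r) : ∃ u, Down G r v u := by
  obtain ⟨u, hu, hd⟩ := exists_adj_toward hG.1 hv
  refine ⟨u, hu, ?_⟩
  rw [G.dist_comm, hd, G.dist_comm]

theorem Down.isUp {v u : V} (h : Down G r v u) : IsUp G r (half G v u) := by
  refine ⟨?_, v, u, h.1, rfl⟩
  rw [mem_half, h.2]
  omega

/-- A halfspace that contains `u` but not `v` would be W(u,v), which contains the root. -/
theorem Down.mem_iff (hG : IsMedian G) {v u : V} (h : Down G r v u) {H : Set V}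
    (hH : IsUp G r H) : v ∈ H ↔ u ∈ H ∨ H = half G v u := by
  obtain ⟨hr, a, b, hab, rfl⟩ := hH
  constructor
  · intro hv
    by_cases hu : u ∈ half G a b
    · exact Or.inl hu
    · exact Or.inr (hG.half_eq_of_cross hab h.1 hv hu).symm
  · rintro (hu | e)
    · by_contra hv
      have e := hG.half_eq_of_cross hab h.1.symm hu hv
      apply hr
      rw [← e, mem_half, h.2]
      omega
    · rw [e]
      exact hG.half_left h.1

theorem Down.mem_half_of_ne (hG : IsMedian G) {v u t : V} (hu : Down G r v u)
    (ht : G.Adj v t) (h : u ≠ t) : u ∈ half G v t := by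
  rw [mem_half, hG.dist_two hu.1.symm ht h, SimpleGraph.dist_eq_one_iff_adj.2 hu.1.symm]
  omega

/-- The first vertex of a halfspace has a neighbour closer to the root; that neighbour comes
earlier, hence lies outside, and the edge between them determines the halfspace. -/
theorem IsUp.label_inj (hG : IsMedian G) (hpos : IsLayered G r pos) {H K : Set V}
    (hH : IsUp G r H) (hK : IsUp G r K) (h : label pos H = label pos K) : H = K := by
  obtain ⟨hr, a, b, hab, rfl⟩ := hH
  obtain ⟨hr', c, e, hce, rfl⟩ := hK
  obtain ⟨x, hx, hxl⟩ := exists_pos_eq_label (pos := pos) ⟨a, hG.half_left hab⟩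
  obtain ⟨x', hx', hxl'⟩ := exists_pos_eq_label (pos := pos) ⟨c, hG.half_left hce⟩
  have e1 : x' = x := hpos.inj (by omega)
  subst e1
  have hne : x' ≠ r := by rintro rfl; exact hr hx
  obtain ⟨y, hy⟩ := exists_down hG hne
  have hlt : pos y < pos x' := hpos.mono _ _ (by have := hy.2; omega)
  have n1 : y ∉ half G a b := fun hm => by
    have := label_le (pos := pos) hm; omega
  have n2 : y ∉ half G c e := fun hm => by
    have := label_le (pos := pos) hm; omega
  rw [← hG.half_eq_of_cross hab hy.1 hx n1, ← hG.half_eq_of_cross hce hy.1 hx' n2]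

/-- For `x` in the halfspace, the median of `r`, `v`, `x` must be `v`: otherwise a step from `v`
towards it would lead to `u`, making `x` closer to `u`. So `v` lies between `r` and `x`. -/
theorem label_half_of_unique (hG : IsMedian G) (hpos : IsLayered G r pos) {v u : V}
    (hu : Down G r v u) (huniq : ∀ u', Down G r v u' → u' = u) :
    label pos (half G v u) = pos v := by
  refine le_antisymm (label_le (hG.half_left hu.1)) ?_
  obtain ⟨x, hx, hxl⟩ := exists_pos_eq_label (pos := pos) ⟨v, hG.half_left hu.1⟩
  rw [← hxl]
  by_cases hxv : x = v
  · rw [hxv]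
  refine (hpos.mono _ _ ?_).le
  obtain ⟨c, h1, h2, h3⟩ := hG.exists_median r v x
  rw [mem_interval] at h1 h2 h3
  have hcv : v = c := by
    by_contra hne
    obtain ⟨u', hu', hd⟩ := exists_adj_toward hG.1 hne
    have h4 := hG.triangle r c u'
    have h5 := hG.triangle r u' v
    have h6 := SimpleGraph.dist_eq_one_iff_adj.2 hu'
    have c1 := G.dist_comm (u := c) (v := u')
    have c2 := G.dist_comm (u := c) (v := v)
    have c3 := G.dist_comm (u := u') (v := v)
    have e : u' = u := huniq u' ⟨hu', by omega⟩
    subst e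
    have h7 := hG.triangle u' c x
    have c4 := G.dist_comm (u := u') (v := x)
    have c5 := G.dist_comm (u := v) (v := x)
    rw [mem_half] at hx
    omega
  subst hcv
  have h4 : G.dist v x ≠ 0 := fun h0 => hxv (hG.eq_of_dist h0).symm
  have c1 := G.dist_comm (u := r) (v := v)
  have c2 := G.dist_comm (u := r) (v := x)
  have c3 := G.dist_comm (u := v) (v := x)
  omega

/-- Induction on the distance to the root. If the separating halfspace `H` of largest label were not
bounded by a downward edge at `v`, it would be the top halfspace of every lower neighbour. Two of
these lead to three squares around a common vertex `x`, and the vertex completing the cube supplies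
a downward edge from `v` across the border of `H`. -/
theorem exists_isTop [Finite V] (hG : IsMedian G) (hpos : IsLayered G r pos) {v : V}
    (hv : v ≠ r) : ∃ u, IsTop G r pos v u := by
  induction hk : G.dist r v using Nat.strong_induction_on generalizing v with
  | _ k ih =>
  obtain ⟨u₁, hu₁⟩ := exists_down hG hv
  by_cases huniq : ∀ u', Down G r v u' → u' = u₁
  · refine ⟨u₁, hu₁, fun H _ hvH => ?_⟩
    rw [label_half_of_unique hG hpos hu₁ huniq]
    exact label_le hvH
  push Not at huniq
  obtain ⟨u₂, hu₂, hne⟩ := huniq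
  by_contra hno
  obtain ⟨H, ⟨hH, hvH⟩, hmax⟩ := Set.exists_max_image {H : Set V | IsUp G r H ∧ v ∈ H} (label pos)
    (Set.toFinite _) ⟨_, hu₁.isUp, hG.half_left hu₁.1⟩
  have hnot : ∀ u, Down G r v u → H ≠ half G v u := by
    rintro u hu rfl
    exact hno ⟨u, hu, fun K hK hvK => hmax K ⟨hK, hvK⟩⟩
  -- A lower neighbour `u` is still in `H`. The top halfspace of `u` also contains `v`, so by
  -- maximality in both directions it is `H`.
  have hdown : ∀ u u', Down G r v u → Down G r v u' → u ≠ u' →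
      ∃ y, Down G r u y ∧ H = half G u y := by
    intro u u' hu hu' huu'
    have huH : u ∈ H := ((hu.mem_iff hG hH).1 hvH).resolve_right (hnot u hu)
    have hur : u ≠ r := by rintro rfl; exact hH.1 huH
    obtain ⟨y, hy, hy'⟩ := ih (G.dist r u) (by have := hu.2; omega) hur rfl
    have h1 := hy' H hH huH
    have h2 := hmax _ ⟨hy.isUp, (hu.mem_iff hG hy.isUp).2 (Or.inl (hG.half_left hy.1))⟩
    exact ⟨y, hy, hH.label_inj hG hpos hy.isUp (le_antisymm h1 h2)⟩
  obtain ⟨y₁, hy₁, e₁⟩ := hdown u₁ u₂ hu₁ hu₂ hne.symm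
  obtain ⟨y₂, hy₂, e₂⟩ := hdown u₂ u₁ hu₂ hu₁ hne
  have d1 := hu₁.2
  have d2 := hu₂.2
  have d3 := hy₁.2
  have d4 := hy₂.2
  obtain ⟨x, hx₁, hx₂, hdx⟩ := hG.quadrangle hu₁.1 hu₂.1 hne.symm d1 d2
  have hvx : v ≠ x := by rintro rfl; omega
  have hu₁x : Down G r u₁ x := ⟨hx₁, hdx⟩
  have hu₂x : Down G r u₂ x := ⟨hx₂, by omega⟩
  have hvy₁ : v ≠ y₁ := by rintro rfl; omega
  have hvy₂ : v ≠ y₂ := by rintro rfl; omega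
  have s₁ := hG.half_square hx₁ hu₁.1.symm hx₂.symm hu₂.1 hne.symm hvx.symm
  have s₂ := hG.half_square hx₂ hu₂.1.symm hx₁.symm hu₁.1 hne hvx.symm
  have hxy₁ : x ≠ y₁ := by
    rintro rfl
    exact hnot u₂ hu₂ (e₁.trans s₁)
  have hxy₂ : x ≠ y₂ := by
    rintro rfl
    exact hnot u₁ hu₁ (e₂.trans s₂)
  obtain ⟨z₁, hz₁, hz₁', hdz₁⟩ := hG.quadrangle hx₁ hy₁.1 hxy₁ hdx d3
  obtain ⟨z₂, hz₂, hz₂', hdz₂⟩ := hG.quadrangle hx₂ hy₂.1 hxy₂ hu₂x.2 d4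
  have hu₁z : u₁ ≠ z₁ := by rintro rfl; omega
  have hu₂z : u₂ ≠ z₂ := by rintro rfl; omega
  have q₁ := hG.half_square hy₁.1 hx₁ hz₁' hz₁ hu₁z hxy₁.symm
  have q₂ := hG.half_square hy₂.1 hx₂ hz₂' hz₂ hu₂z hxy₂.symm
  -- Both edges `x z₁` and `x z₂` leave `H`, and a vertex has at most one edge across a given
  -- border.
  have hz : z₂ = z₁ := by
    by_contra hzne
    have h1 : z₂ ∈ half G x z₁ := Down.mem_half_of_ne (r := r) hG ⟨hz₂, hdz₂⟩ hz₁ hzne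
    rw [← q₁, ← e₁, e₂, q₂] at h1
    exact hG.not_half_right h1
  subst hz
  have hy : y₁ ≠ y₂ := by
    rintro rfl
    exact hnot u₂ hu₂ (e₁.trans
      (hG.half_square hy₁.1 hu₁.1.symm hy₂.1.symm hu₂.1 hne.symm hvy₁.symm))
  have a1 := hG.dist_two hz₁' hz₂'.symm hy
  have a2 := hG.dist_two hy₁.1.symm hu₁.1.symm hvy₁.symm
  have a3 := hG.dist_two hy₂.1.symm hu₂.1.symm hvy₂.symm
  -- The three vertices are pairwise at distance two, so their median is adjacent to all of them. It
  -- lies outside `H` because `y₁` and `y₂` do and one vertex cannot have two edges across the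
  -- border.
  obtain ⟨t, t1, t2, t3⟩ := hG.exists_median y₁ y₂ v
  rw [mem_interval] at t1 t2 t3
  have c1 := G.dist_comm (u := y₁) (v := t)
  have c2 := G.dist_comm (u := y₂) (v := t)
  have c3 := G.dist_comm (u := v) (v := t)
  have c4 := G.dist_comm (u := v) (v := y₁)
  have ty₁ : G.Adj t y₁ := SimpleGraph.dist_eq_one_iff_adj.1 (by omega)
  have ty₂ : G.Adj t y₂ := SimpleGraph.dist_eq_one_iff_adj.1 (by omega)
  have tv : G.Adj v t := SimpleGraph.dist_eq_one_iff_adj.1 (by omega)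
  have hy₁H : y₁ ∉ H := by rw [e₁]; exact hG.not_half_right
  have hy₂H : y₂ ∉ H := by rw [e₂]; exact hG.not_half_right
  obtain ⟨hr, a, b, hab, rfl⟩ := hH
  have htH : t ∉ half G a b := by
    intro ht
    have h1 := hG.half_eq_of_cross hab ty₁ ht hy₁H
    apply hy₂H
    rw [← h1, mem_half, G.dist_comm, G.dist_comm (v := y₁),
      SimpleGraph.dist_eq_one_iff_adj.2 ty₂]
    omega
  have h1 := hG.half_eq_of_cross hab tv hvH htH
  refine hnot t ⟨tv, ?_⟩ h1.symm
  rw [← h1, mem_half] at hr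
  have := hG.dist_adj tv r
  omega

/-- `k` is the largest label of a halfspace that separates `v` from the root, or `0` at the
root. -/
def IsTopLabel (G : SimpleGraph V) (r : V) (pos : V → ℕ) (v : V) (k : ℕ) : Prop :=
  (v = r ∧ k = 0) ∨ ∃ u, IsTop G r pos v u ∧ k = label pos (half G v u)

/-- Since `u` is in W(v,t), the top halfspace of `v` separates `u` from the root too; conversely,
all halfspaces separating `u` also separate `v`. -/
theorem IsTop.topLabel_of_ne {g : V → ℕ} {v t : V} (ht : IsTop G r pos v t) (hG : IsMedian G)
    (hg : ∀ u, Down G r v u → IsTopLabel G r pos u (g u)) {u : V} (hu : Down G r v u)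
    (hut : u ≠ t) :
    g u = label pos (half G v t) := by
  have hmem := hu.mem_half_of_ne hG ht.1.1 hut
  rcases hg u hu with ⟨rfl, _⟩ | ⟨y, hy, e⟩
  · exact absurd hmem ht.1.isUp.1
  · rw [e]
    refine le_antisymm (ht.2 _ hy.1.isUp ?_) (hy.2 _ ht.1.isUp hmem)
    exact (hu.mem_iff hG hy.1.isUp).2 (Or.inl (hG.half_left hy.1.1))

/-- The vertex `t` loses exactly the halfspace W(v,t) on which the maximum was attained. If `t` is
the root, its label is 0, while position 0 belongs to no halfspace avoiding the root. -/
theorem IsTop.topLabel_lt {g : V → ℕ} {v t : V} (ht : IsTop G r pos v t) (hG : IsMedian G)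
    (hpos : IsLayered G r pos) (hg : ∀ u, Down G r v u → IsTopLabel G r pos u (g u)) :
    g t < label pos (half G v t) := by
  rcases hg t ht.1 with ⟨rfl, e⟩ | ⟨y, hy, e⟩
  · rw [e, Nat.pos_iff_ne_zero]
    intro h0
    obtain ⟨x, hx, hxl⟩ := exists_pos_eq_label (pos := pos) ⟨v, hG.half_left ht.1.1⟩
    have : x = t := hpos.inj (by rw [hpos.root]; omega)
    exact ht.1.isUp.1 (this ▸ hx)
  · rw [e]
    refine lt_of_le_of_ne (ht.2 _ hy.1.isUp
      ((ht.1.mem_iff hG hy.1.isUp).2 (Or.inl (hG.half_left hy.1.1)))) fun h => ?_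
    have h1 := hy.1.isUp.label_inj hG hpos ht.1.isUp h
    have h2 := hG.half_left hy.1.1
    rw [h1] at h2
    exact hG.not_half_right h2

/-- Only the true parent deviates from the common label of the lower neighbours, and it deviates
downwards; so a strict minimum identifies it and the maximum is the label sought. -/
theorem isTop_of_lt [Finite V] (hG : IsMedian G) (hpos : IsLayered G r pos) {g : V → ℕ} {v : V}
    (hg : ∀ u, Down G r v u → IsTopLabel G r pos u (g u))
    {f : V} {k : ℕ} (hf : Down G r v f) (hmin : ∀ u, Down G r v u → g f ≤ g u)
    (hmax : ∀ u, Down G r v u → g u ≤ k) (hk : ∃ u, Down G r v u ∧ g u = k) (hlt : g f < k) :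
    IsTop G r pos v f ∧ k = label pos (half G v f) := by
  have hv : v ≠ r := by rintro rfl; have := hf.2; simp at this
  obtain ⟨t, ht⟩ := exists_isTop hG hpos hv
  have h1 := ht.topLabel_lt hG hpos hg
  have hft : f = t := by
    by_contra hne
    have h2 := ht.topLabel_of_ne hG hg hf hne
    have := hmin t ht.1
    omega
  subst hft
  obtain ⟨u, hu, rfl⟩ := hk
  exact ⟨ht, ht.topLabel_of_ne hG hg hu (by rintro rfl; omega)⟩

/-- The parent's label is strictly smaller than that of any other lower neighbour, so equal labels
mean that there is no other. -/
theorem isTop_of_eq [Finite V] (hG : IsMedian G) (hpos : IsLayered G r pos) {g : V → ℕ} {v : V}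
    (hg : ∀ u, Down G r v u → IsTopLabel G r pos u (g u))
    {f : V} (hf : Down G r v f) (heq : ∀ u, Down G r v u → g u = g f) :
    IsTop G r pos v f ∧ pos v = label pos (half G v f) := by
  have hv : v ≠ r := by rintro rfl; have := hf.2; simp at this
  obtain ⟨t, ht⟩ := exists_isTop hG hpos hv
  have h1 := ht.topLabel_lt hG hpos hg
  have huniq : ∀ u, Down G r v u → u = t := by
    intro u hu
    by_contra hne
    have h2 := ht.topLabel_of_ne hG hg hu hne
    have h3 := heq u hu
    have h4 := heq t ht.1
    omega
  have hft := huniq f hf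
  subst hft
  exact ⟨ht, (label_half_of_unique hG hpos hf huniq).symm⟩

open Classical in
/-- Whether the halfspace with label `k` separates `v` from the root. -/
noncomputable def sep (G : SimpleGraph V) (r : V) (pos : V → ℕ) (k : ℕ) (v : V) : ℝ :=
  if ∃ H, IsUp G r H ∧ label pos H = k ∧ v ∈ H then 1 else 0

theorem sep_root (k : ℕ) : sep G r pos k r = 0 := by
  classical
  refine if_neg ?_
  rintro ⟨H, hH, -, hr⟩
  exact hH.1 hr

-- Along a downward edge exactly one separating halfspace is lost. Iterated along parents, this
-- counts each separating halfspace once on the way to the root.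
open Classical in
theorem sep_eq_add (hG : IsMedian G) (hpos : IsLayered G r pos) {v u : V} (hu : Down G r v u)
    (k : ℕ) :
    sep G r pos k v = sep G r pos k u + if label pos (half G v u) = k then 1 else 0 := by
  have huu : u ∉ half G v u := hG.not_half_right
  unfold sep
  by_cases h : label pos (half G v u) = k
  · have h1 : ∃ H, IsUp G r H ∧ label pos H = k ∧ v ∈ H := ⟨_, hu.isUp, h, hG.half_left hu.1⟩
    have h2 : ¬ ∃ H, IsUp G r H ∧ label pos H = k ∧ u ∈ H := by
      rintro ⟨H, hH, e, huH⟩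
      exact huu (hH.label_inj hG hpos hu.isUp (e.trans h.symm) ▸ huH)
    rw [if_pos h1, if_neg h2, if_pos h, zero_add]
  · have h1 : (∃ H, IsUp G r H ∧ label pos H = k ∧ v ∈ H) ↔
        ∃ H, IsUp G r H ∧ label pos H = k ∧ u ∈ H := by
      refine exists_congr fun H => and_congr_right fun hH => and_congr_right fun e => ?_
      rw [hu.mem_iff hG hH, or_iff_left]
      rintro rfl
      exact h e
    rw [if_neg h, add_zero]
    exact if_congr h1 rfl rfl

theorem weight_half_eq_sum_sep [Fintype V] (w : V → ℝ) (hG : IsMedian G)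
    (hpos : IsLayered G r pos) {v u : V} (hu : Down G r v u) :
    weight w (half G v u) = ∑ y, w y * sep G r pos (label pos (half G v u)) y := by
  classical
  refine Finset.sum_congr rfl fun y _ => ?_
  unfold sep
  have h : (∃ H, IsUp G r H ∧ label pos H = label pos (half G v u) ∧ y ∈ H) ↔
      y ∈ half G v u := by
    constructor
    · rintro ⟨H, hH, e, hy⟩
      exact hH.label_inj hG hpos hu.isUp e ▸ hy
    · exact fun hy => ⟨_, hu.isUp, rfl, hy⟩
  by_cases hy : y ∈ half G v u
  · rw [if_pos hy, if_pos (h.2 hy), mul_one]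
  · rw [if_neg hy, if_neg fun h' => hy (h.1 h'), mul_zero]

/-- The first and the last median vertex in a layered order with a positive root. -/
theorem first_last_medianSet [Fintype V] {w : V → ℝ} (hG : IsMedian G) (hw : ∀ x, 0 ≤ w x)
    (hr : 0 < w r) (hpos : IsLayered G r pos) {u v : V} (hu : u ∈ medianSet G w)
    (hv : v ∈ medianSet G w) (hfirst : ∀ z ∈ medianSet G w, pos u ≤ pos z)
    (hlast : ∀ z ∈ medianSet G w, pos z ≤ pos v) :
    0 < weight w (fiber G (medianSet G w) u) ∧ IsFarthest G (medianSet G w) u v := by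
  have hgate : IsGate G (medianSet G w) r u :=
    hG.isGate_of_nearest (fun x hx y hy z hz => medianSet_convex hG hw hx hy hz) hu
      fun z hz => not_lt.1 fun h => absurd (hfirst z hz) (not_le.2 (hpos.mono _ _ h))
  refine ⟨weight_pos_of_mem hw (S := fiber G _ u) hgate hr, hv, fun z hz => ?_⟩
  have h1 : G.dist r z ≤ G.dist r v :=
    not_lt.1 fun h => absurd (hlast z hz) (not_le.2 (hpos.mono _ _ h))
  -- Distances from `r` to median vertices are those from the gate `u` plus a constant, so farthest
  -- from `r` means farthest from `u`.
  have h2 := hgate.2 z hz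
  have h3 := hgate.2 v hv
  rw [mem_interval] at h2 h3
  have c1 := G.dist_comm (u := r) (v := z)
  have c2 := G.dist_comm (u := r) (v := v)
  have c3 := G.dist_comm (u := u) (v := z)
  have c4 := G.dist_comm (u := u) (v := v)
  omega

end Labels

/-! ### Execution and running time of programs -/

namespace State

@[simp] theorem setWord_word (s : State) (x k : ℕ) :
    (s.setWord x k).word = Function.update s.word x k := rfl
@[simp] theorem setWord_real (s : State) (x k : ℕ) : (s.setWord x k).real = s.real := rfl
@[simp] theorem setWord_wordArr (s : State) (x k : ℕ) :
    (s.setWord x k).wordArr = s.wordArr := rfl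
@[simp] theorem setWord_realArr (s : State) (x k : ℕ) :
    (s.setWord x k).realArr = s.realArr := rfl
@[simp] theorem setReal_word (s : State) (x : ℕ) (k : ℝ) : (s.setReal x k).word = s.word := rfl
@[simp] theorem setReal_real (s : State) (x : ℕ) (k : ℝ) :
    (s.setReal x k).real = Function.update s.real x k := rfl
@[simp] theorem setReal_wordArr (s : State) (x : ℕ) (k : ℝ) :
    (s.setReal x k).wordArr = s.wordArr := rfl
@[simp] theorem setReal_realArr (s : State) (x : ℕ) (k : ℝ) :
    (s.setReal x k).realArr = s.realArr := rfl
@[simp] theorem setWordArr_word (s : State) (a i k : ℕ) :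
    (s.setWordArr a i k).word = s.word := rfl
@[simp] theorem setWordArr_real (s : State) (a i k : ℕ) :
    (s.setWordArr a i k).real = s.real := rfl
@[simp] theorem setWordArr_wordArr (s : State) (a i k : ℕ) : (s.setWordArr a i k).wordArr =
    Function.update s.wordArr a (Function.update (s.wordArr a) i k) := rfl
@[simp] theorem setWordArr_realArr (s : State) (a i k : ℕ) :
    (s.setWordArr a i k).realArr = s.realArr := rfl
@[simp] theorem setRealArr_word (s : State) (a i : ℕ) (k : ℝ) :
    (s.setRealArr a i k).word = s.word := rfl
@[simp] theorem setRealArr_real (s : State) (a i : ℕ) (k : ℝ) :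
    (s.setRealArr a i k).real = s.real := rfl
@[simp] theorem setRealArr_wordArr (s : State) (a i : ℕ) (k : ℝ) :
    (s.setRealArr a i k).wordArr = s.wordArr := rfl
@[simp] theorem setRealArr_realArr (s : State) (a i : ℕ) (k : ℝ) : (s.setRealArr a i k).realArr =
    Function.update s.realArr a (Function.update (s.realArr a) i k) := rfl

end State

namespace Prog

open Classical in
/-- The effect of a loop-free program. -/
noncomputable def run : Prog → State → State
  | skip, s => s
  | setWord x e, s => s.setWord x (e.eval s)
  | setReal x e, s => s.setReal x (e.eval s)
  | putWord a i e, s => s.setWordArr a (i.eval s) (e.eval s)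
  | putReal a i e, s => s.setRealArr a (i.eval s) (e.eval s)
  | seq p q, s => q.run (p.run s)
  | branch b p q, s => if b.Holds s then p.run s else q.run s
  | loop _ _, s => s

/-- The program is loop-free and does not overflow. -/
def Safe (B : ℕ) : Prog → State → Prop
  | skip, _ => True
  | setWord _ e, s => e.Fits B s
  | setReal _ e, s => e.Fits B s
  | putWord _ i e, s => i.Fits B s ∧ e.Fits B s
  | putReal _ i e, s => i.Fits B s ∧ e.Fits B s
  | seq p q, s => p.Safe B s ∧ q.Safe B (p.run s)
  | branch b p q, s => b.Fits B s ∧ (b.Holds s → p.Safe B s) ∧ (¬ b.Holds s → q.Safe B s)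
  | loop _ _, _ => False

/-- A bound on the running time of a loop-free program. -/
def bound : Prog → ℕ
  | skip => 1
  | setWord _ e => e.cost + 1
  | setReal _ e => e.cost + 1
  | putWord _ i e => i.cost + e.cost + 1
  | putReal _ i e => i.cost + e.cost + 1
  | seq p q => p.bound + q.bound
  | branch b p q => b.cost + 1 + (p.bound + q.bound)
  | loop _ _ => 0

end Prog

/-- Started in `s`, the program halts within time `T` in a state that satisfies `Q`. -/
def Runs (B : ℕ) (p : Prog) (s : State) (T : ℕ) (Q : State → Prop) : Prop :=
  ∃ t s', Exec B p s t s' ∧ t ≤ T ∧ Q s'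

namespace Runs

variable {B : ℕ}

theorem mono {p : Prog} {s : State} {T T' : ℕ} {Q Q' : State → Prop} (h : Runs B p s T Q)
    (hT : T ≤ T') (hQ : ∀ s', Q s' → Q' s') : Runs B p s T' Q' := by
  obtain ⟨t, s', h1, h2, h3⟩ := h
  exact ⟨t, s', h1, h2.trans hT, hQ s' h3⟩

theorem seq {p q : Prog} {s : State} {T T' : ℕ} {Q Q' : State → Prop} (h : Runs B p s T Q)
    (h' : ∀ s', Q s' → Runs B q s' T' Q') : Runs B (Prog.seq p q) s (T + T') Q' := by
  obtain ⟨t, s', h1, h2, h3⟩ := h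
  obtain ⟨t', s'', h4, h5, h6⟩ := h' s' h3
  exact ⟨t + t', s'', Exec.seq _ _ _ _ _ _ _ h1 h4, by omega, h6⟩

theorem exec_run {p : Prog} {s : State} (h : p.Safe B s) :
    ∃ t, Exec B p s t (p.run s) ∧ t ≤ p.bound := by
  induction p generalizing s with
  | skip => exact ⟨_, Exec.skip s, le_rfl⟩
  | setWord x e => exact ⟨_, Exec.setWord x e s h, le_rfl⟩
  | setReal x e => exact ⟨_, Exec.setReal x e s h, le_rfl⟩
  | putWord a i e => exact ⟨_, Exec.putWord a i e s h.1 h.2, le_rfl⟩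
  | putReal a i e => exact ⟨_, Exec.putReal a i e s h.1 h.2, le_rfl⟩
  | seq p q ihp ihq =>
    obtain ⟨t, h1, h2⟩ := ihp h.1
    obtain ⟨t', h3, h4⟩ := ihq h.2
    exact ⟨_, Exec.seq _ _ _ _ _ _ _ h1 h3, Nat.add_le_add h2 h4⟩
  | branch b p q ihp ihq =>
    obtain ⟨hf, hp, hq⟩ := h
    by_cases hb : b.Holds s
    · obtain ⟨t, h1, h2⟩ := ihp (hp hb)
      refine ⟨b.cost + 1 + t, ?_, ?_⟩
      · rw [Prog.run, if_pos hb]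
        exact Exec.branch_true _ _ _ _ _ _ hf hb h1
      · simp only [Prog.bound]; omega
    · obtain ⟨t, h1, h2⟩ := ihq (hq hb)
      refine ⟨b.cost + 1 + t, ?_, ?_⟩
      · rw [Prog.run, if_neg hb]
        exact Exec.branch_false _ _ _ _ _ _ hf hb h1
      · simp only [Prog.bound]; omega
  | loop b p => exact h.elim

theorem straight {p : Prog} {s : State} {T : ℕ} {Q : State → Prop} (h : p.Safe B s)
    (hT : p.bound ≤ T) (hQ : Q (p.run s)) : Runs B p s T Q := by
  obtain ⟨t, h1, h2⟩ := exec_run h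
  exact ⟨t, _, h1, h2.trans hT, hQ⟩

/-- Loops whose iterations are numbered from `m` to `M`, with a potential that pays for them. -/
theorem loop_potential {b : Test} {p : Prog} {Inv : ℕ → State → Prop} {φ : ℕ → State → ℕ}
    {m M : ℕ} (hm : m ≤ M)
    (htest : ∀ i s, i ≤ M → Inv i s → b.Fits B s ∧ (b.Holds s ↔ i < M))
    (hstep : ∀ i s, m ≤ i → i < M → Inv i s → ∃ T, Runs B p s T fun s' =>
      Inv (i + 1) s' ∧ φ i s + T + (b.cost + 1) ≤ φ (i + 1) s')
    {s : State} (hs : Inv m s) :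
    ∃ t s', Exec B (Prog.loop b p) s t s' ∧ t + φ m s ≤ φ M s' + (b.cost + 1) ∧ Inv M s' := by
  induction hk : M - m generalizing m s with
  | zero =>
    have : m = M := by omega
    subst this
    obtain ⟨h1, h2⟩ := htest m s le_rfl hs
    exact ⟨_, s, Exec.loop_false _ _ _ h1 (fun h => absurd (h2.1 h) (lt_irrefl _)), by omega, hs⟩
  | succ k ih =>
    obtain ⟨h1, h2⟩ := htest m s hm hs
    obtain ⟨T, t, s', h3, h4, h5, h6⟩ := hstep m s le_rfl (by omega) hs
    obtain ⟨t', s'', h7, h8, h9⟩ := ih (m := m + 1) (by omega)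
      (fun i s hi => hstep i s (by omega)) h5 (by omega)
    exact ⟨_, s'', Exec.loop_true _ _ _ _ _ _ _ h1 (h2.2 (by omega)) h3 h7, by omega, h9⟩

theorem loop {b : Test} {p : Prog} {Inv : ℕ → State → Prop} {K m M : ℕ} (hm : m ≤ M)
    (htest : ∀ i s, i ≤ M → Inv i s → b.Fits B s ∧ (b.Holds s ↔ i < M))
    (hstep : ∀ i s, m ≤ i → i < M → Inv i s → Runs B p s K (Inv (i + 1)))
    {s : State} (hs : Inv m s) :
    Runs B (Prog.loop b p) s ((M - m) * (K + (b.cost + 1)) + (b.cost + 1)) (Inv M) := by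
  obtain ⟨t, s', h1, h2, h3⟩ := loop_potential (φ := fun i _ => (i - m) * (K + (b.cost + 1))) hm
    htest (fun i s hi hi' hI => ⟨K, (hstep i s hi hi' hI).mono le_rfl fun s' h => ⟨h, by
      rw [Nat.succ_sub hi, Nat.succ_mul]; omega⟩⟩) hs
  refine ⟨t, s', h1, ?_, h3⟩
  simpa using h2

end Runs

attribute [simp] WExp.eval WExp.cost WExp.Fits RExp.eval RExp.cost RExp.Fits Test.Holds Test.cost
  Test.Fits Prog.run Prog.Safe

/-! ### Initialization, and the invariants of breadth-first search -/

section Phases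

open Prog

/-- The state holds adjacency lists for `n` vertices. -/
def HoldsLists (n : ℕ) (off adj : ℕ → ℕ) (s : State) : Prop :=
  s.word 0 = n ∧ s.wordArr 0 = off ∧ s.wordArr 1 = adj

theorem update_prefix {α : Type*} {f : ℕ → α} {i : ℕ} {c : α} (h : ∀ x < i, f x = c) :
    ∀ x ≤ i, Function.update f i c x = c := by
  intro x hx
  rcases hx.lt_or_eq with h1 | rfl
  · rw [Function.update_of_ne h1.ne, h x h1]
  · rw [Function.update_self]

/-- One iteration of the initialization. -/
def initBody : Prog :=
  -- The value `n` marks an unvisited vertex, as all distances are smaller.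
  seq (putWord 3 (.var 2) (.var 0)) <|
  seq (putReal 1 (.var 2) .zero) <|
  seq (setReal 0 (.add (.var 0) (.get 0 (.var 2)))) <|
  seq (branch (.realLt .zero (.get 0 (.var 2))) (setWord 8 (.var 2)) skip) <|
  setWord 2 (.add (.var 2) (.const 1))

/-- Marks all vertices as unvisited, sums up the weights, and finds a root of positive weight. -/
def initProg : Prog :=
  seq (seq (setWord 2 (.const 0)) (setReal 0 .zero)) <|
  loop (.wordLt (.var 2) (.var 0)) initBody

/-- Memory layout of all phases. Word arrays: 0 and 1 adjacency lists, 2 queue, 3 distances, 4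
labels, 5 parents. Real arrays: 0 weights, 1 halfspace weights, 2 median function. Word variables: 2
queue position, 3 and 5 current position and end in a list, 4 current vertex, 6 neighbour, 7 queue
length, 8 root; 9, 10, 11 are scratch. Real variables: 0 total weight, 1 best value. -/
theorem initProg_runs {B n : ℕ} {off adj : ℕ → ℕ} {W : ℕ → ℝ} (hB : n + 2 ≤ B) {s : State}
    (hs : HoldsLists n off adj s) (hW : s.realArr 0 = W) (hpos : ∃ x < n, 0 < W x) :
    Runs B initProg s (40 * (n + 1)) fun s' => HoldsLists n off adj s' ∧ s'.realArr 0 = W ∧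
      (∀ x < n, s'.wordArr 3 x = n) ∧ (∀ x < n, s'.realArr 1 x = 0) ∧
      s'.real 0 = ∑ x ∈ Finset.range n, W x ∧ s'.word 8 < n ∧ 0 < W (s'.word 8) := by
  set Inv : ℕ → State → Prop := fun i s => HoldsLists n off adj s ∧ s.realArr 0 = W ∧
      s.word 2 = i ∧
      (∀ x < i, s.wordArr 3 x = n) ∧ (∀ x < i, s.realArr 1 x = 0) ∧
      s.real 0 = ∑ x ∈ Finset.range i, W x ∧
      -- Variable 8 is arbitrary until a positive weight has been met, so nothing is claimed about
      -- it before.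
      (∀ x < i, 0 < W x → s.word 8 < n ∧ 0 < W (s.word 8)) with hInv
  have h0 : Runs B (seq (setWord 2 (.const 0)) (setReal 0 .zero)) s 4 (Inv 0) := by
    refine Runs.straight ?_ le_rfl ?_
    · simp
    · simpa [hInv, HoldsLists, hW] using hs
  refine (h0.seq fun s' hs' => Runs.loop (K := 26) (m := 0) (M := n) (Nat.zero_le n) ?_ ?_ hs').mono
    ?_ fun s' hs' => ?_
  · rintro i s hi ⟨⟨hn, _⟩, _, h2, _⟩
    simp [h2, hn]
    omega
  · rintro i s - hi ⟨⟨hn, ho, ha⟩, h1, h2, h3, h4, h5, h6⟩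
    have h7 : s.real 0 + W i = ∑ x ∈ Finset.range (i + 1), W x := by
      rw [Finset.sum_range_succ, h5]
    by_cases hc : 0 < W i
    · refine Runs.straight ?_ (by decide) ?_
      · simp [initBody, h1, h2, hn, hc]
        omega
      · simp [initBody, hInv, HoldsLists, h1, h2, hn, hc]
        exact ⟨⟨ho, ha⟩, update_prefix h3, update_prefix h4, h7, fun _ _ _ => hi⟩
    · refine Runs.straight ?_ (by decide) ?_
      · simp [initBody, h1, h2, hn, hc]
        omega
      · simp [initBody, hInv, HoldsLists, h1, h2, hn, hc]
        refine ⟨⟨ho, ha⟩, update_prefix h3, update_prefix h4, h7, fun x hx hx' => ?_⟩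
        rcases hx.lt_or_eq with h | rfl
        · exact h6 x h hx'
        · exact absurd hx' hc
  · simp only [Test.cost, WExp.cost]
    omega
  · obtain ⟨h1, h2, h3, h4, h5, h6, h7⟩ := hs'
    obtain ⟨x, hx, hx'⟩ := hpos
    exact ⟨h1, h2, h4, h5, h6, h7 x hx hx'⟩

/-- `u` is listed as a neighbour of `v`. -/
def Listed (off adj : ℕ → ℕ) (v u : ℕ) : Prop :=
  ∃ j, off v ≤ j ∧ j < off (v + 1) ∧ adj j = u

/-- Adjacency lists of a connected graph on `0, …, n - 1` with the distances `d` to a root `r`. -/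
structure Rooted (n : ℕ) (off adj : ℕ → ℕ) (r : ℕ) (d : ℕ → ℕ) : Prop where
  root_lt : r < n
  off_zero : off 0 = 0
  off_le : ∀ v < n, off v ≤ off (v + 1)
  listed_lt : ∀ v < n, ∀ u, Listed off adj v u → u < n
  listed_symm : ∀ v < n, ∀ u, Listed off adj v u → Listed off adj u v
  d_root : d r = 0
  d_lt : ∀ x < n, d x < n
  d_le : ∀ v < n, ∀ u, Listed off adj v u → d u ≤ d v + 1
  parent : ∀ x < n, x ≠ r → ∃ y < n, Listed off adj y x ∧ d x = d y + 1

/-- `Q` lists the vertices in an order of nondecreasing distance. -/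
structure Ordered (n r : ℕ) (d Q : ℕ → ℕ) : Prop where
  lt : ∀ k < n, Q k < n
  inj : ∀ k < n, ∀ l < n, Q k = Q l → k = l
  surj : ∀ x < n, ∃ k < n, Q k = x
  zero : Q 0 = r
  mono : ∀ k l, k ≤ l → l < n → d (Q k) ≤ d (Q l)

/-- The state of a breadth-first search: queue `Q` of length `tl`, distance labels `D` (`n` for
unvisited vertices), the first `i` vertices of the queue having been processed. -/
structure Searching (n : ℕ) (off adj : ℕ → ℕ) (r : ℕ) (d Q D : ℕ → ℕ) (tl i : ℕ) : Prop where
  le : i ≤ tl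
  pos : 0 < tl
  lt : ∀ k < tl, Q k < n
  inj : ∀ k < tl, ∀ l < tl, Q k = Q l → k = l
  zero : Q 0 = r
  label : ∀ k < tl, D (Q k) = d (Q k)
  unvisited : ∀ x < n, D x = n ∨ ∃ k < tl, Q k = x
  mono : ∀ k l, k ≤ l → l < tl → d (Q k) ≤ d (Q l)
  width : i < tl → ∀ k < tl, d (Q k) ≤ d (Q i) + 1
  done : ∀ k < i, ∀ x, Listed off adj (Q k) x → ∃ l < tl, Q l = x

namespace Rooted

variable {n r : ℕ} {off adj d : ℕ → ℕ}

theorem off_mono (h : Rooted n off adj r d) {k l : ℕ} (hkl : k ≤ l) (hl : l ≤ n) :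
    off k ≤ off l := by
  induction l, hkl using Nat.le_induction with
  | base => exact le_rfl
  | succ l hkl ih => exact (ih (by omega)).trans (h.off_le l hl)

end Rooted

namespace Searching

variable {n r tl i : ℕ} {off adj d Q D : ℕ → ℕ}

theorem tl_le (h : Searching n off adj r d Q D tl i) : tl ≤ n := by
  have h1 : (Finset.range tl).card ≤ (Finset.range n).card := by
    refine Finset.card_le_card_of_injOn Q (fun k hk => ?_) fun k hk l hl e => ?_
    · exact Finset.mem_coe.2 (Finset.mem_range.2 (h.lt k (Finset.mem_range.1 hk)))
    · exact h.inj k (Finset.mem_range.1 hk) l (Finset.mem_range.1 hl) e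
  simpa using h1

/-- Induction on the distance: a parent of `x` is in the queue and nearer than `Q i`, hence already
processed, so `x` was discovered. -/
theorem visited_of_le (hR : Rooted n off adj r d) (h : Searching n off adj r d Q D tl i)
    {x : ℕ} (hx : x < n) (hd : d x ≤ d (Q i)) : ∃ k < tl, Q k = x := by
  induction hk : d x generalizing x with
  | zero =>
    by_cases hxr : x = r
    · exact ⟨0, h.pos, h.zero.trans hxr.symm⟩
    · obtain ⟨y, _, _, h3⟩ := hR.parent x hx hxr
      omega
  | succ m ih =>
    have hxr : x ≠ r := by rintro rfl; rw [hR.d_root] at hk; omega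
    obtain ⟨y, h1, h2, h3⟩ := hR.parent x hx hxr
    obtain ⟨k, hk', rfl⟩ := ih h1 (by omega) (by omega)
    refine h.done k ?_ x h2
    by_contra hki
    have := h.mono i k (by omega) hk'
    omega

/-- If the whole queue had been processed, the visited set would be closed under neighbours, hence
contain all `n` vertices, by connectivity. -/
theorem lt_tl (hR : Rooted n off adj r d) (h : Searching n off adj r d Q D tl i)
    (hi : i < n) : i < tl := by
  by_contra hcon
  have hall : ∀ m, ∀ x < n, d x = m → ∃ k < tl, Q k = x := by
    intro m
    induction m with
    | zero =>
      intro x hx hd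
      by_cases hxr : x = r
      · exact ⟨0, h.pos, h.zero.trans hxr.symm⟩
      · obtain ⟨y, _, _, h3⟩ := hR.parent x hx hxr
        omega
    | succ m ih =>
      intro x hx hd
      have hxr : x ≠ r := by rintro rfl; rw [hR.d_root] at hd; omega
      obtain ⟨y, h1, h2, h3⟩ := hR.parent x hx hxr
      obtain ⟨k, hk', rfl⟩ := ih y h1 (by omega)
      exact h.done k (by omega) x h2
  have h1 : (Finset.range n) ⊆ (Finset.range tl).image Q := by
    intro x hx
    obtain ⟨k, hk, e⟩ := hall _ x (Finset.mem_range.1 hx) rfl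
    exact Finset.mem_image.2 ⟨k, Finset.mem_range.2 hk, e⟩
  have h2 := (Finset.card_le_card h1).trans Finset.card_image_le
  simp only [Finset.card_range] at h2
  omega

/-- A newly discovered vertex is appended to the queue. -/
theorem push (hR : Rooted n off adj r d) (h : Searching n off adj r d Q D tl i)
    (hi : i < tl) {u : ℕ} (hu : Listed off adj (Q i) u) (hD : D u = n) :
    Searching n off adj r d (Function.update Q tl u) (Function.update D u (D (Q i) + 1))
      (tl + 1) i := by
  have hun : u < n := hR.listed_lt _ (h.lt i hi) u hu
  have hnew : ∀ k < tl, Q k ≠ u := by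
    rintro k hk rfl
    have h1 := h.label k hk
    have h2 := hR.d_lt _ (h.lt k hk)
    omega
  have hQ : ∀ k < tl, Function.update Q tl u k = Q k := fun k hk =>
    Function.update_of_ne hk.ne _ _
  have hQt : Function.update Q tl u tl = u := Function.update_self ..
  -- A vertex at distance at most that of `Q i` would already be visited.
  have hdu : d u = d (Q i) + 1 := by
    refine le_antisymm (hR.d_le _ (h.lt i hi) u hu) ?_
    by_contra hlt
    obtain ⟨k, hk, e⟩ := h.visited_of_le hR hun (by omega)
    exact hnew k hk e
  have hcase : ∀ k < tl + 1, (k < tl ∧ Function.update Q tl u k = Q k) ∨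
      (k = tl ∧ Function.update Q tl u k = u) := by
    intro k hk
    rcases Nat.lt_succ_iff_lt_or_eq.1 hk with h1 | rfl
    · exact Or.inl ⟨h1, hQ k h1⟩
    · exact Or.inr ⟨rfl, hQt⟩
  refine ⟨by omega, by omega, ?_, ?_, ?_, ?_, ?_, ?_, ?_, ?_⟩
  · intro k hk
    rcases hcase k hk with ⟨h1, e⟩ | ⟨h1, e⟩ <;> rw [e]
    · exact h.lt k h1
    · exact hun
  · intro k hk l hl
    rcases hcase k hk with ⟨h1, e⟩ | ⟨h1, e⟩ <;> rcases hcase l hl with ⟨h2, e'⟩ | ⟨h2, e'⟩ <;>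
      rw [e, e']
    · exact h.inj k h1 l h2
    · exact fun h3 => absurd h3 (hnew k h1)
    · exact fun h3 => absurd h3.symm (hnew l h2)
    · intro; omega
  · rw [hQ 0 h.pos, h.zero]
  · intro k hk
    rcases hcase k hk with ⟨h1, e⟩ | ⟨h1, e⟩ <;> rw [e]
    · rw [Function.update_of_ne (hnew k h1), h.label k h1]
    · rw [Function.update_self, h.label i hi, hdu]
  · intro x hx
    by_cases hxu : x = u
    · exact Or.inr ⟨tl, by omega, by rw [hQt, hxu]⟩
    · rw [Function.update_of_ne hxu]
      rcases h.unvisited x hx with h1 | ⟨k, h1, h2⟩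
      · exact Or.inl h1
      · exact Or.inr ⟨k, by omega, by rw [hQ k h1, h2]⟩
  · intro k l hkl hl
    rcases hcase l hl with ⟨h1, e⟩ | ⟨h1, e⟩ <;> rw [e]
    · rw [hQ k (by omega)]
      exact h.mono k l hkl h1
    · rcases hcase k (by omega) with ⟨h2, e'⟩ | ⟨h2, e'⟩ <;> rw [e']
      rw [hdu]
      exact h.width hi k h2
  · intro _ k hk
    rw [hQ i hi]
    rcases hcase k hk with ⟨h1, e⟩ | ⟨h1, e⟩ <;> rw [e]
    · exact h.width hi k h1
    · exact hdu.le
  · intro k hk x hx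
    rw [hQ k (by omega)] at hx
    obtain ⟨l, hl, e⟩ := h.done k hk x hx
    exact ⟨l, by omega, by rw [hQ l hl, e]⟩

theorem label_le (hR : Rooted n off adj r d) (h : Searching n off adj r d Q D tl i) {x : ℕ}
    (hx : x < n) : D x ≤ n := by
  rcases h.unvisited x hx with h1 | ⟨k, hk, rfl⟩
  · exact h1.le
  · rw [h.label k hk]
    exact (hR.d_lt _ hx).le

theorem next (h : Searching n off adj r d Q D tl i) (hi : i < tl)
    (hdone : ∀ x, Listed off adj (Q i) x → ∃ l < tl, Q l = x) :
    Searching n off adj r d Q D tl (i + 1) := by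
  refine ⟨hi, h.pos, h.lt, h.inj, h.zero, h.label, h.unvisited, h.mono, fun hi' k hk => ?_,
    fun k hk x hx => ?_⟩
  · have h1 := h.width hi k hk
    have h2 := h.mono i (i + 1) (by omega) hi'
    omega
  · rcases Nat.lt_succ_iff_lt_or_eq.1 hk with h1 | rfl
    · exact h.done k h1 x hx
    · exact hdone x hx

theorem ordered (h : Searching n off adj r d Q D tl n) :
    Ordered n r d Q ∧ ∀ x < n, D x = d x := by
  have htl : tl = n := le_antisymm h.tl_le h.le
  subst htl
  have hsurj : ∀ x < tl, ∃ k < tl, Q k = x := by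
    intro x hx
    have h1 : (Finset.range tl).image Q = Finset.range tl := by
      refine Finset.eq_of_subset_of_card_le (fun y hy => ?_) ?_
      · obtain ⟨k, hk, rfl⟩ := Finset.mem_image.1 hy
        exact Finset.mem_range.2 (h.lt k (Finset.mem_range.1 hk))
      · rw [Finset.card_image_of_injOn]
        exact fun k hk l hl e =>
          h.inj k (Finset.mem_range.1 hk) l (Finset.mem_range.1 hl) e
    have h2 := Finset.mem_range.2 hx
    rw [← h1] at h2
    obtain ⟨k, hk, e⟩ := Finset.mem_image.1 h2
    exact ⟨k, Finset.mem_range.1 hk, e⟩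
  refine ⟨⟨h.lt, h.inj, hsurj, h.zero, h.mono⟩, fun x hx => ?_⟩
  obtain ⟨k, hk, rfl⟩ := hsurj x hx
  exact h.label k hk

end Searching

theorem Ordered.sum_eq {n r : ℕ} {d Q : ℕ → ℕ} (h : Ordered n r d Q) {M : Type*}
    [AddCommMonoid M] (f : ℕ → M) :
    ∑ k ∈ Finset.range n, f (Q k) = ∑ x ∈ Finset.range n, f x := by
  refine Finset.sum_nbij Q ?_ ?_ ?_ fun _ _ => rfl
  · exact fun k hk => Finset.mem_range.2 (h.lt k (Finset.mem_range.1 hk))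
  · exact fun k hk l hl e => h.inj k (by simpa using hk) l (by simpa using hl) e
  · intro x hx
    obtain ⟨k, hk, e⟩ := h.surj x (by simpa using hx)
    exact ⟨k, by simpa using hk, e⟩

theorem Rooted.sum_deg {n r : ℕ} {off adj d Q : ℕ → ℕ} (hR : Rooted n off adj r d)
    (hQ : Ordered n r d Q) :
    ∑ k ∈ Finset.range n, (off (Q k + 1) - off (Q k)) = off n := by
  rw [hQ.sum_eq fun x => off (x + 1) - off x]
  have h : ∀ m ≤ n, ∑ x ∈ Finset.range m, (off (x + 1) - off x) = off m := by
    intro m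
    induction m with
    | zero => simp [hR.off_zero]
    | succ m ih =>
      intro hm
      rw [Finset.sum_range_succ, ih (by omega)]
      have := hR.off_le m hm
      omega
  exact h n le_rfl

end Phases

/-! ### Breadth-first search -/

section Search

open Prog

/-- Amortization: an iteration is charged to the list length of its vertex. The queue may grow
during the loop, so the potential refers to the current queue, whose processed entries no longer
change. -/
theorem Runs.loop_queue {B n E C : ℕ} {off : ℕ → ℕ} {b : Test} {p : Prog}
    {Inv : ℕ → State → Prop}
    (htest : ∀ i s, i ≤ n → Inv i s → b.Fits B s ∧ (b.Holds s ↔ i < n))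
    (hstep : ∀ i s, i < n → Inv i s →
      Runs B p s (C * (1 + (off (s.wordArr 2 i + 1) - off (s.wordArr 2 i)))) fun s' =>
        Inv (i + 1) s' ∧ ∀ k ≤ i, s'.wordArr 2 k = s.wordArr 2 k)
    (hE : ∀ s, Inv n s → ∑ k ∈ Finset.range n,
      (off (s.wordArr 2 k + 1) - off (s.wordArr 2 k)) = E)
    {s : State} (hs : Inv 0 s) :
    Runs B (Prog.loop b p) s ((C + (b.cost + 1)) * (n + E) + (b.cost + 1)) (Inv n) := by
  obtain ⟨t, s', h1, h2, h3⟩ := Runs.loop_potential (m := 0) (φ := fun i s =>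
    (C + (b.cost + 1)) * (i + ∑ k ∈ Finset.range i,
      (off (s.wordArr 2 k + 1) - off (s.wordArr 2 k)))) (Nat.zero_le n)
    htest (fun i s _ hi hI => ⟨_, (hstep i s hi hI).mono le_rfl fun s' hs' => ⟨hs'.1, by
      have e : ∑ k ∈ Finset.range i, (off (s'.wordArr 2 k + 1) - off (s'.wordArr 2 k)) =
          ∑ k ∈ Finset.range i, (off (s.wordArr 2 k + 1) - off (s.wordArr 2 k)) :=
        Finset.sum_congr rfl fun k hk => by rw [hs'.2 k (Finset.mem_range.1 hk).le]
      rw [Finset.sum_range_succ, hs'.2 i le_rfl, e]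
      generalize off (s.wordArr 2 i + 1) - off (s.wordArr 2 i) = x
      nlinarith [Nat.zero_le (b.cost * x)]⟩⟩) hs
  refine ⟨t, s', h1, ?_, h3⟩
  simp only [hE s' h3] at h2
  omega

/-- Loads the next vertex of the queue and the bounds of its list. -/
def openList : Prog :=
  seq (setWord 4 (.get 2 (.var 2))) <|
  seq (setWord 3 (.get 0 (.var 4))) <|
  setWord 5 (.get 0 (.add (.var 4) (.const 1)))

/-- Visits one neighbour. -/
def searchStep : Prog :=
  seq (setWord 6 (.get 1 (.var 3))) <|
  seq (branch (.wordEq (.get 3 (.var 6)) (.var 0))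
    (seq (putWord 2 (.var 7) (.var 6)) <|
      seq (setWord 7 (.add (.var 7) (.const 1))) <|
      putWord 3 (.var 6) (.add (.get 3 (.var 4)) (.const 1)))
    skip) <|
  setWord 3 (.add (.var 3) (.const 1))

/-- Processes one vertex of the queue. -/
def searchBody : Prog :=
  seq openList <|
  seq (loop (.wordLt (.var 3) (.var 5)) searchStep) <|
  setWord 2 (.add (.var 2) (.const 1))

/-- Breadth-first search. -/
def searchProg : Prog :=
  seq (seq (putWord 2 (.const 0) (.var 8)) <| seq (putWord 3 (.var 8) (.const 0)) <|
    seq (setWord 7 (.const 1)) (setWord 2 (.const 0))) <|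
  loop (.wordLt (.var 2) (.var 0)) searchBody

/-- The invariant of the breadth-first search. -/
def SearchInv (n : ℕ) (off adj : ℕ → ℕ) (r : ℕ) (d : ℕ → ℕ) (ρ : ℕ → ℝ) (ρA : ℕ → ℕ → ℝ)
    (i : ℕ) (s : State) : Prop :=
  HoldsLists n off adj s ∧ s.real = ρ ∧ s.realArr = ρA ∧ s.word 8 = r ∧ s.word 2 = i ∧
    Searching n off adj r d (s.wordArr 2) (s.wordArr 3) (s.word 7) i

theorem searchBody_runs {B n r : ℕ} {off adj d : ℕ → ℕ} (hR : Rooted n off adj r d)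
    (hB : n + 2 ≤ B) (hB' : off n + 2 ≤ B) {ρ : ℕ → ℝ} {ρA : ℕ → ℕ → ℝ} {i : ℕ} (hi : i < n)
    {s : State} (hs : SearchInv n off adj r d ρ ρA i s) :
    Runs B searchBody s (60 * (1 + (off (s.wordArr 2 i + 1) - off (s.wordArr 2 i)))) fun s' =>
        SearchInv n off adj r d ρ ρA (i + 1) s' ∧ ∀ k ≤ i, s'.wordArr 2 k = s.wordArr 2 k := by
  obtain ⟨⟨hn, ho, ha⟩, hρ, hρA, hr, h2, hS⟩ := hs
  have hit := hS.lt_tl hR hi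
  set Q := s.wordArr 2 with hQ
  set v := Q i with hv
  have hvn : v < n := hS.lt i hit
  have hov := hR.off_le v hvn
  have hon := hR.off_mono (show v + 1 ≤ n from hvn) le_rfl
  set Inv : ℕ → State → Prop := fun j s => SearchInv n off adj r d ρ ρA i s ∧ s.word 3 = j ∧
    s.word 4 = v ∧ s.word 5 = off (v + 1) ∧ i < s.word 7 ∧ (∀ k ≤ i, s.wordArr 2 k = Q k) ∧
    ∀ j', off v ≤ j' → j' < j → ∃ l < s.word 7, s.wordArr 2 l = adj j' with hInv
  have h0 : Runs B openList s 12 (Inv (off v)) := by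
    refine Runs.straight ?_ (by decide) ?_
    · simp [openList, h2, ho, ← hQ, ← hv]
      omega
    · simp [openList, hInv, SearchInv, HoldsLists, h2, ho, ha, hn, ← hQ, ← hv, hρ, hρA, hr]
      exact ⟨hS, hit, fun j' h1 h3 => by omega⟩
  refine (h0.seq fun s' hs' => (Runs.loop (K := 38) (m := off v) (M := off (v + 1)) hov ?_ ?_
    hs').seq (T' := 4) fun s'' hs'' => ?_).mono ?_ fun s' hs' => hs'
  · rintro j s hj ⟨-, h3, -, h5, -⟩
    simp [h3, h5]
    omega
  · rintro j s hj hj' ⟨⟨⟨hn, ho, ha⟩, hρ, hρA, hr, h2, hS⟩, h3, h4, h5, h6, h7, h8⟩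
    have hl : Listed off adj v (adj j) := ⟨j, hj, hj', rfl⟩
    have hun := hR.listed_lt v hvn _ hl
    have hvi : s.wordArr 2 i = v := h7 i le_rfl
    have hDv : s.wordArr 3 v < n := by
      rw [← hvi, hS.label i h6, hvi]; exact hR.d_lt v hvn
    have hDu := hS.label_le hR hun
    have htl := hS.tl_le
    by_cases hc : s.wordArr 3 (adj j) = n
    · have hS' := hS.push hR h6 (by rw [hvi]; exact hl) hc
      rw [hvi] at hS'
      refine Runs.straight ?_ (by decide) ?_
      · simp [searchStep, h3, h4, ha, hn, hc]
        omega
      · simp [searchStep, hInv, SearchInv, HoldsLists, h2, h3, h4, h5, ho, ha, hn, hρ, hρA, hr,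
          hc]
        refine ⟨hS', by omega, fun k hk => ?_, fun j' h9 h10 => ?_⟩
        · rw [Function.update_of_ne (by omega), h7 k hk]
        · rcases h10.lt_or_eq with h11 | rfl
          · obtain ⟨l, hl, e⟩ := h8 j' h9 h11
            exact ⟨l, by omega, by rw [Function.update_of_ne hl.ne, e]⟩
          · exact ⟨s.word 7, le_rfl, Function.update_self ..⟩
    · refine Runs.straight ?_ (by decide) ?_
      · simp [searchStep, h3, ha, hn, hc]
        omega
      · simp [searchStep, hInv, SearchInv, HoldsLists, h2, h3, h4, h5, ho, ha, hn, hρ, hρA, hr,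
          hc]
        refine ⟨hS, h6, h7, fun j' h9 h10 => ?_⟩
        rcases h10.lt_or_eq with h11 | rfl
        · exact h8 j' h9 h11
        · exact (hS.unvisited _ hun).resolve_left hc
  · obtain ⟨⟨⟨hn, ho, ha⟩, hρ, hρA, hr, h2, hS⟩, h3, h4, h5, h6, h7, h8⟩ := hs''
    refine Runs.straight ?_ (by decide) ?_
    · simp [h2]
      omega
    · simp [SearchInv, HoldsLists, h2, ho, ha, hn, hρ, hρA, hr]
      refine ⟨hS.next h6 ?_, h7⟩
      rintro x ⟨j, hj, hj', rfl⟩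
      rw [h7 i le_rfl] at hj hj'
      exact h8 j hj hj'
  · simp only [Test.cost, WExp.cost]
    omega

theorem searchProg_runs {B n r : ℕ} {off adj d : ℕ → ℕ} (hR : Rooted n off adj r d)
    (hB : n + 2 ≤ B) (hB' : off n + 2 ≤ B) {s : State} (hs : HoldsLists n off adj s)
    (hr : s.word 8 = r) (hD : ∀ x < n, s.wordArr 3 x = n) :
    Runs B searchProg s (80 * (n + off n + 1)) fun s' => HoldsLists n off adj s' ∧
      s'.real = s.real ∧ s'.realArr = s.realArr ∧ s'.word 8 = r ∧
      Ordered n r d (s'.wordArr 2) ∧ ∀ x < n, s'.wordArr 3 x = d x := by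
  have hrn := hR.root_lt
  have h0 : Runs B (seq (putWord 2 (.const 0) (.var 8)) <| seq (putWord 3 (.var 8) (.const 0)) <|
      seq (setWord 7 (.const 1)) (setWord 2 (.const 0))) s 10
      (SearchInv n off adj r d s.real s.realArr 0) := by
    obtain ⟨hn, ho, ha⟩ := hs
    refine Runs.straight ?_ (by decide) ?_
    · simp [hr]
      omega
    · simp [SearchInv, HoldsLists, hn, ho, ha, hr]
      refine ⟨by omega, by omega, ?_, ?_, ?_, ?_, ?_, ?_, ?_, ?_⟩
      · intro k hk
        have : k = 0 := by omega
        subst this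
        simpa using hrn
      · intro k hk l hl _
        omega
      · simp
      · intro k hk
        have : k = 0 := by omega
        subst this
        simp [hR.d_root]
      · intro x hx
        by_cases hxr : x = r
        · exact Or.inr ⟨0, by omega, by simp [hxr]⟩
        · left
          rw [Function.update_of_ne hxr, hD x hx]
      · intro k l hkl hl
        have : k = l := by omega
        rw [this]
      · intro _ k hk
        have : k = 0 := by omega
        subst this
        omega
      · intro k hk
        omega
  refine (h0.seq fun s' hs' => Runs.loop_queue (C := 60) (E := off n) (off := off) ?_
    (fun i s hi h => searchBody_runs hR hB hB' hi h) ?_ hs').mono ?_ fun s' hs' => ?_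
  · rintro i s hi ⟨⟨hn, _⟩, _, _, _, h2, _⟩
    simp [h2, hn]
    omega
  · rintro s ⟨_, _, _, _, _, hS⟩
    exact hR.sum_deg hS.ordered.1
  · simp only [Test.cost, WExp.cost]
    omega
  · obtain ⟨h1, h2, h3, h4, _, hS⟩ := hs'
    exact ⟨h1, h2, h3, h4, hS.ordered.1, hS.ordered.2⟩

end Search

/-! ### Computing labels and parents -/

section Label

open Prog

/-- An admissible assignment `Good v k f` of labels `k` and parents `f` to the vertices `v`, in a
form that can be computed along the queue `Q`. -/
structure Labelling (n : ℕ) (off adj : ℕ → ℕ) (r : ℕ) (d Q : ℕ → ℕ)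
    (Good : ℕ → ℕ → ℕ → Prop) : Prop where
  root : ∀ x, Good r 0 x
  lt : ∀ v < n, ∀ k f, Good v k f → k < n
  step : ∀ i < n, Q i ≠ r → ∀ (g : ℕ → ℕ) (f k : ℕ),
    (∀ u, Listed off adj (Q i) u → d u < d (Q i) → ∃ f', Good u (g u) f') →
    Listed off adj (Q i) f → d f < d (Q i) →
    (∀ u, Listed off adj (Q i) u → d u < d (Q i) → g f ≤ g u ∧ g u ≤ k) →
    (g f < k → (∃ u, Listed off adj (Q i) u ∧ d u < d (Q i) ∧ g u = k) → Good (Q i) k f) ∧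
    (¬ g f < k → Good (Q i) i f)

/-- The minimum `mn` (attained at `fv`) and the maximum `mx` of `g` over the neighbours of `v`
closer to the root, among the list positions before `j`. -/
structure Scanned (n : ℕ) (off adj d g : ℕ → ℕ) (v j mn mx fv : ℕ) : Prop where
  bounds : ∀ j', off v ≤ j' → j' < j → d (adj j') < d v → mn ≤ g (adj j') ∧ g (adj j') ≤ mx
  min : mn = n ∨ (Listed off adj v fv ∧ d fv < d v ∧ g fv = mn)
  max : mx = 0 ∨ ∃ u, Listed off adj v u ∧ d u < d v ∧ g u = mx
  min_le : mn ≤ n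
  max_le : mx ≤ n
  lt : fv < n

/-- Scans one neighbour. -/
def labelStep : Prog :=
  seq (setWord 6 (.get 1 (.var 3))) <|
  seq (branch (.wordLt (.get 3 (.var 6)) (.get 3 (.var 4)))
    (seq (branch (.wordLt (.get 4 (.var 6)) (.var 9))
        (seq (setWord 9 (.get 4 (.var 6))) (setWord 11 (.var 6))) skip) <|
      branch (.wordLt (.var 10) (.get 4 (.var 6))) (setWord 10 (.get 4 (.var 6))) skip)
    skip) <|
  setWord 3 (.add (.var 3) (.const 1))

/-- Labels one vertex of the queue. -/
def labelBody : Prog :=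
  seq (seq openList <|
    -- The minimum starts at `n`, above all labels, and the maximum at 0. At the root nothing is
    -- scanned, so the later test fails and the root receives its own position 0 as label.
    seq (setWord 9 (.var 0)) <| seq (setWord 10 (.const 0)) (setWord 11 (.const 0))) <|
  seq (loop (.wordLt (.var 3) (.var 5)) labelStep) <|
  seq (branch (.wordLt (.var 9) (.var 10)) (putWord 4 (.var 4) (.var 10))
    (putWord 4 (.var 4) (.var 2))) <|
  seq (putWord 5 (.var 4) (.var 11)) <|
  setWord 2 (.add (.var 2) (.const 1))

/-- Computes the labels and the parents. -/
def labelProg : Prog :=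
  seq (setWord 2 (.const 0)) <|
  loop (.wordLt (.var 2) (.var 0)) labelBody

/-- The invariant of the labelling phase. -/
def LabelInv (n : ℕ) (off adj Q D : ℕ → ℕ) (r : ℕ) (ρ : ℕ → ℝ) (ρA : ℕ → ℕ → ℝ)
    (Good : ℕ → ℕ → ℕ → Prop) (i : ℕ) (s : State) : Prop :=
  HoldsLists n off adj s ∧ s.real = ρ ∧ s.realArr = ρA ∧ s.word 8 = r ∧ s.word 2 = i ∧
    s.wordArr 2 = Q ∧ s.wordArr 3 = D ∧
    ∀ k < i, Good (Q k) (s.wordArr 4 (Q k)) (s.wordArr 5 (Q k)) ∧ s.wordArr 5 (Q k) < n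

theorem labelStep_runs {B n r i v j : ℕ} {off adj d Q D : ℕ → ℕ} {Good : ℕ → ℕ → ℕ → Prop}
    (hR : Rooted n off adj r d)
    (hB : n + 2 ≤ B) (hB' : off n + 2 ≤ B) {ρ : ℕ → ℝ} {ρA : ℕ → ℕ → ℝ} (hvn : v < n)
    (hD : ∀ x < n, D x = d x)
    (hj : off v ≤ j) (hj' : j < off (v + 1)) {s : State}
    (hs : LabelInv n off adj Q D r ρ ρA Good i s)
    (hg : ∀ u, Listed off adj v u → d u < d v → s.wordArr 4 u < n)
    (h3 : s.word 3 = j) (h4 : s.word 4 = v) (h5 : s.word 5 = off (v + 1))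
    (hS : Scanned n off adj d (s.wordArr 4) v j (s.word 9) (s.word 10) (s.word 11)) :
    Runs B labelStep s 60 fun s' => LabelInv n off adj Q D r ρ ρA Good i s' ∧
      s'.wordArr 4 = s.wordArr 4 ∧ s'.word 3 = j + 1 ∧ s'.word 4 = v ∧
      s'.word 5 = off (v + 1) ∧
      Scanned n off adj d (s.wordArr 4) v (j + 1) (s'.word 9) (s'.word 10) (s'.word 11) := by
  obtain ⟨⟨hn, ho, ha⟩, hρ, hρA, hr, h2, hQ, hs3, hGood⟩ := hs
  have hl : Listed off adj v (adj j) := ⟨j, hj, hj', rfl⟩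
  have hun := hR.listed_lt v hvn _ hl
  have hDu := hD _ hun
  have hDv := hD v hvn
  have hdu := hR.d_lt _ hun
  have hdv := hR.d_lt v hvn
  have hon := hR.off_mono (show v + 1 ≤ n from hvn) le_rfl
  obtain ⟨b1, b2, b3, b4, b5, b6⟩ := hS
  have hnew : ∀ {mn mx : ℕ}, (∀ j', off v ≤ j' → j' < j → d (adj j') < d v →
      mn ≤ s.wordArr 4 (adj j') ∧ s.wordArr 4 (adj j') ≤ mx) →
      (d (adj j) < d v → mn ≤ s.wordArr 4 (adj j) ∧ s.wordArr 4 (adj j) ≤ mx) →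
      ∀ j', off v ≤ j' → j' < j + 1 → d (adj j') < d v →
        mn ≤ s.wordArr 4 (adj j') ∧ s.wordArr 4 (adj j') ≤ mx := by
    intro mn mx h1 h2 j' h3 h4
    rcases Nat.lt_succ_iff_lt_or_eq.1 h4 with h5 | rfl
    · exact h1 j' h3 h5
    · exact h2
  by_cases hc : d (adj j) < d v
  · have hgu := hg _ hl hc
    by_cases hc1 : s.wordArr 4 (adj j) < s.word 9
    · by_cases hc2 : s.word 10 < s.wordArr 4 (adj j)
      · refine Runs.straight ?_ (by decide) ?_
        · simp [labelStep, h3, h4, ha, hs3, hDu, hDv, hc, hc1, hc2]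
          omega
        · simp [labelStep, LabelInv, HoldsLists, h2, h3, h4, h5, ha, ho, hn, hρ, hρA, hr, hQ,
            hs3, hDu, hDv, hc, hc1, hc2]
          refine ⟨hGood, hnew (fun j' x y z => ?_) fun _ => ⟨le_rfl, le_rfl⟩,
            Or.inr ⟨hl, hc, rfl⟩, Or.inr ⟨_, hl, hc, rfl⟩, hgu.le, hgu.le, hun⟩
          have := b1 j' x y z
          omega
      · refine Runs.straight ?_ (by decide) ?_
        · simp [labelStep, h3, h4, ha, hs3, hDu, hDv, hc, hc1, hc2]
          omega
        · simp [labelStep, LabelInv, HoldsLists, h2, h3, h4, h5, ha, ho, hn, hρ, hρA, hr, hQ,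
            hs3, hDu, hDv, hc, hc1, hc2]
          refine ⟨hGood, hnew (fun j' x y z => ?_) fun _ => ⟨le_rfl, not_lt.1 hc2⟩,
            Or.inr ⟨hl, hc, rfl⟩, b3, hgu.le, b5, hun⟩
          have := b1 j' x y z
          omega
    · by_cases hc2 : s.word 10 < s.wordArr 4 (adj j)
      · refine Runs.straight ?_ (by decide) ?_
        · simp [labelStep, h3, h4, ha, hs3, hDu, hDv, hc, hc1, hc2]
          omega
        · simp [labelStep, LabelInv, HoldsLists, h2, h3, h4, h5, ha, ho, hn, hρ, hρA, hr, hQ,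
            hs3, hDu, hDv, hc, hc1, hc2]
          refine ⟨hGood, hnew (fun j' x y z => ?_) fun _ => ⟨not_lt.1 hc1, le_rfl⟩,
            b2, Or.inr ⟨_, hl, hc, rfl⟩, b4, hgu.le, b6⟩
          have := b1 j' x y z
          omega
      · refine Runs.straight ?_ (by decide) ?_
        · simp [labelStep, h3, h4, ha, hs3, hDu, hDv, hc, hc1, hc2]
          omega
        · simp [labelStep, LabelInv, HoldsLists, h2, h3, h4, h5, ha, ho, hn, hρ, hρA, hr, hQ,
            hs3, hDu, hDv, hc, hc1, hc2]
          exact ⟨hGood, hnew b1 fun _ => ⟨not_lt.1 hc1, not_lt.1 hc2⟩, b2, b3, b4, b5, b6⟩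
  · refine Runs.straight ?_ (by decide) ?_
    · simp [labelStep, h3, h4, ha, hs3, hDu, hDv, hc]
      omega
    · simp [labelStep, LabelInv, HoldsLists, h2, h3, h4, h5, ha, ho, hn, hρ, hρA, hr, hQ,
        hs3, hDu, hDv, hc]
      exact ⟨hGood, hnew b1 fun h => absurd h hc, b2, b3, b4, b5, b6⟩

theorem labelBody_runs {B n r i : ℕ} {off adj d Q D : ℕ → ℕ} {Good : ℕ → ℕ → ℕ → Prop}
    (hR : Rooted n off adj r d) (hO : Ordered n r d Q) (hL : Labelling n off adj r d Q Good)
    (hB : n + 2 ≤ B) (hB' : off n + 2 ≤ B) {ρ : ℕ → ℝ} {ρA : ℕ → ℕ → ℝ}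
    (hD : ∀ x < n, D x = d x) (hi : i < n) {s : State}
    (hs : LabelInv n off adj Q D r ρ ρA Good i s) :
    Runs B labelBody s (100 * (1 + (off (s.wordArr 2 i + 1) - off (s.wordArr 2 i)))) fun s' =>
        LabelInv n off adj Q D r ρ ρA Good (i + 1) s' ∧
        ∀ k ≤ i, s'.wordArr 2 k = s.wordArr 2 k := by
  obtain ⟨⟨hn, ho, ha⟩, hρ, hρA, hr, h2, hQ, hs3, hGood⟩ := hs
  rw [hQ]
  set v := Q i with hv
  have hvn : v < n := hO.lt i hi
  have hov := hR.off_le v hvn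
  have hon := hR.off_mono (show v + 1 ≤ n from hvn) le_rfl
  set g := s.wordArr 4 with hg
  -- Neighbours closer to the root come earlier in the queue, so their labels are final.
  have hdown : ∀ u, Listed off adj v u → d u < d v → Good u (g u) (s.wordArr 5 u) := by
    intro u hu hdu
    obtain ⟨k, hk, rfl⟩ := hO.surj u (hR.listed_lt v hvn u hu)
    refine (hGood k ?_).1
    by_contra hik
    have : d v ≤ d (Q k) := hO.mono i k (by omega) hk
    omega
  have hglt : ∀ u, Listed off adj v u → d u < d v → g u < n := fun u hu hdu =>
    hL.lt u (hR.listed_lt v hvn u hu) _ _ (hdown u hu hdu)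
  set Inv : ℕ → State → Prop := fun j s => LabelInv n off adj Q D r ρ ρA Good i s ∧
    s.wordArr 4 = g ∧ s.word 3 = j ∧ s.word 4 = v ∧ s.word 5 = off (v + 1) ∧
    Scanned n off adj d g v j (s.word 9) (s.word 10) (s.word 11) with hInv
  have h0 : Runs B (seq openList <| seq (setWord 9 (.var 0)) <| seq (setWord 10 (.const 0))
      (setWord 11 (.const 0))) s 20 (Inv (off v)) := by
    refine Runs.straight ?_ (by decide) ?_
    · simp [openList, h2, ho, hQ, ← hv, hn]
      omega
    · simp [openList, hInv, LabelInv, HoldsLists, h2, ho, ha, hn, hQ, ← hv, hρ, hρA, hr, hs3,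
        ← hg]
      exact ⟨hGood, fun j' h1 h3 => by omega, Or.inl rfl, Or.inl rfl, le_rfl, Nat.zero_le _,
        by omega⟩
  refine (h0.seq fun s' hs' => (Runs.loop (K := 60) (m := off v) (M := off (v + 1)) hov ?_ ?_
    hs').seq (T' := 18) fun s'' hs'' => ?_).mono ?_ fun s' hs' => hs'
  · rintro j s hj ⟨-, -, h3, -, h5, -⟩
    simp [h3, h5]
    omega
  · rintro j s hj hj' ⟨hI, hg', h3, h4, h5, hS⟩
    refine (labelStep_runs hR hB hB' hvn hD hj hj' hI ?_ h3 h4 h5 ?_).mono le_rfl ?_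
    · rw [hg']; exact hglt
    · rw [hg']; exact hS
    · rintro s' ⟨c1, c2, c3, c4, c5, c6⟩
      rw [hg'] at c2 c6
      exact ⟨c1, c2, c3, c4, c5, c6⟩
  · obtain ⟨⟨⟨hn, ho, ha⟩, hρ, hρA, hr, h2, hQ, hs3, hGood⟩, hg', h3, h4, h5,
      b1, b2, b3, b4, b5, b6⟩ := hs''
    have hbd : ∀ u, Listed off adj v u → d u < d v → s''.word 9 ≤ g u ∧ g u ≤ s''.word 10 := by
      rintro u ⟨j, hj, hj', rfl⟩ hd
      exact b1 j hj hj' hd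
    have hne : ∀ k < i, Q k ≠ v := fun k hk e => by
      have := hO.inj k (by omega) i hi e
      omega
    have hparent : v ≠ r → Listed off adj v (s''.word 11) ∧ d (s''.word 11) < d v ∧
        g (s''.word 11) = s''.word 9 := by
      intro hvr
      obtain ⟨y, hy, hy', hdy⟩ := hR.parent v hvn hvr
      have hyl := hR.listed_symm y hy v hy'
      have h6 := (hbd y hyl (by omega)).1
      have h7 := hglt y hyl (by omega)
      exact b2.resolve_left (by omega)
    have hroot : v = r → s''.word 9 = n ∧ s''.word 10 = 0 ∧ i = 0 := by
      intro hvr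
      have hno : ∀ u, ¬ d u < d v := by
        rw [hvr, hR.d_root]
        omega
      refine ⟨b2.resolve_right fun h => hno _ h.2.1, b3.resolve_right ?_, ?_⟩
      · rintro ⟨u, _, h, _⟩
        exact hno _ h
      · exact hO.inj i hi 0 (by omega) (by rw [hO.zero, ← hvr])
    by_cases hc : s''.word 9 < s''.word 10
    · have hvr : v ≠ r := by
        intro hvr
        have := hroot hvr
        omega
      obtain ⟨p1, p2, p3⟩ := hparent hvr
      have hnew := ((hL.step i hi hvr g (s''.word 11) (s''.word 10)
        (fun u hu hd => ⟨_, hdown u hu hd⟩) p1 p2 (by rw [p3]; exact hbd)).1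
        (by omega) (b3.resolve_left (by omega)))
      refine Runs.straight ?_ (by decide) ?_
      · simp [h2, h4, hc]
        omega
      · simp [LabelInv, HoldsLists, h2, ho, ha, hn, hρ, hρA, hr, hs3, hQ, h4, hc, hg']
        intro k hk
        rcases hk.lt_or_eq with h6 | rfl
        · have h7 := hGood k h6
          rw [hg'] at h7
          rw [Function.update_of_ne (hne k h6), Function.update_of_ne (hne k h6)]
          exact h7
        · rw [← hv, Function.update_self, Function.update_self]
          exact ⟨hnew, b6⟩
    · have hnew : Good v i (s''.word 11) := by
        by_cases hvr : v = r
        · rw [(hroot hvr).2.2, hvr]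
          exact hL.root _
        · obtain ⟨p1, p2, p3⟩ := hparent hvr
          exact (hL.step i hi hvr g (s''.word 11) (s''.word 10)
            (fun u hu hd => ⟨_, hdown u hu hd⟩) p1 p2 (by rw [p3]; exact hbd)).2 (by omega)
      refine Runs.straight ?_ (by decide) ?_
      · simp [h2, h4, hc]
        omega
      · simp [LabelInv, HoldsLists, h2, ho, ha, hn, hρ, hρA, hr, hs3, hQ, h4, hc, hg']
        intro k hk
        rcases hk.lt_or_eq with h6 | rfl
        · have h7 := hGood k h6
          rw [hg'] at h7
          rw [Function.update_of_ne (hne k h6), Function.update_of_ne (hne k h6)]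
          exact h7
        · rw [← hv, Function.update_self, Function.update_self]
          exact ⟨hnew, b6⟩
  · simp only [Test.cost, WExp.cost]
    omega

theorem labelProg_runs {B n r : ℕ} {off adj d Q : ℕ → ℕ} {Good : ℕ → ℕ → ℕ → Prop}
    (hR : Rooted n off adj r d) (hO : Ordered n r d Q) (hL : Labelling n off adj r d Q Good)
    (hB : n + 2 ≤ B) (hB' : off n + 2 ≤ B) {s : State} (hs : HoldsLists n off adj s)
    (hr : s.word 8 = r) (hQ : s.wordArr 2 = Q) (hD : ∀ x < n, s.wordArr 3 x = d x) :
    Runs B labelProg s (110 * (n + off n + 1)) fun s' => HoldsLists n off adj s' ∧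
      s'.real = s.real ∧ s'.realArr = s.realArr ∧ s'.word 8 = r ∧ s'.wordArr 2 = Q ∧
      ∀ x < n, Good x (s'.wordArr 4 x) (s'.wordArr 5 x) ∧ s'.wordArr 5 x < n := by
  have h0 : Runs B (setWord 2 (.const 0)) s 2
      (LabelInv n off adj Q (s.wordArr 3) r s.real s.realArr Good 0) := by
    obtain ⟨hn, ho, ha⟩ := hs
    refine Runs.straight ?_ (by decide) ?_
    · simp
    · simp [LabelInv, HoldsLists, hn, ho, ha, hr, hQ]
  refine (h0.seq fun s' hs' => Runs.loop_queue (C := 100) (E := off n) (off := off) ?_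
    (fun i s hi h => labelBody_runs hR hO hL hB hB' hD hi h) ?_ hs').mono ?_ fun s' hs' => ?_
  · rintro i s hi ⟨⟨hn, _⟩, _, _, _, h2, _⟩
    simp [h2, hn]
    omega
  · rintro s ⟨_, _, _, _, _, hQ, _⟩
    rw [hQ]
    exact hR.sum_deg hO
  · simp only [Test.cost, WExp.cost]
    omega
  · obtain ⟨h1, h2, h3, h4, _, h5, _, h6⟩ := hs'
    refine ⟨h1, h2, h3, h4, h5, fun x hx => ?_⟩
    obtain ⟨k, hk, rfl⟩ := hO.surj x hx
    exact h6 k hk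

end Label

/-! ### Halfspace weights and the minima of the median function -/

section Select

open Prog

/-- Parents `f` and labels `g` along the queue `Q`; `χ k v` indicates whether the label `k` occurs
on the path of parents from `v` to the root. -/
structure IsTree (n r : ℕ) (Q g f : ℕ → ℕ) (χ : ℕ → ℕ → ℝ) : Prop where
  lt : ∀ k < n, Q k < n
  inj : ∀ k < n, ∀ l < n, Q k = Q l → k = l
  zero : Q 0 = r
  label_lt : ∀ k < n, g (Q k) < n
  parent : ∀ k < n, 0 < k → ∃ m < k, f (Q k) = Q m
  root : ∀ l, χ l r = 0
  path : ∀ k < n, 0 < k → ∀ l, χ l (Q k) = χ l (f (Q k)) + if g (Q k) = l then 1 else 0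

/-- Moving the weight of the last vertex to its parent loses, for each label `l`, exactly the term
in which the edge to the parent carries `l`; the update of `P` restores it. The sum is thus
invariant in the backward pass. -/
theorem IsTree.push_weight {n r : ℕ} {Q g f : ℕ → ℕ} {χ : ℕ → ℕ → ℝ} (h : IsTree n r Q g f χ)
    {i : ℕ} (hi : i < n) (h0 : 0 < i) (W P : ℕ → ℝ) (l : ℕ) :
    Function.update P (g (Q i)) (P (g (Q i)) + W (Q i)) l + ∑ m ∈ Finset.range i,
      Function.update W (f (Q i)) (W (f (Q i)) + W (Q i)) (Q m) * χ l (Q m) =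
    P l + ∑ m ∈ Finset.range (i + 1), W (Q m) * χ l (Q m) := by
  obtain ⟨m', hm', hf⟩ := h.parent i hi h0
  have h1 : ∑ m ∈ Finset.range i,
      Function.update W (f (Q i)) (W (f (Q i)) + W (Q i)) (Q m) * χ l (Q m) =
      ∑ m ∈ Finset.range i, (W (Q m) * χ l (Q m) +
        if m = m' then W (Q i) * χ l (f (Q i)) else 0) := by
    refine Finset.sum_congr rfl fun m hm => ?_
    have hm := Finset.mem_range.1 hm
    by_cases e : m = m'
    · subst e
      rw [hf, Function.update_self, if_pos rfl]
      ring
    · rw [if_neg e, Function.update_of_ne, add_zero]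
      rw [hf]
      exact fun e' => e (h.inj m (by omega) m' (by omega) e')
  rw [h1, Finset.sum_add_distrib, Finset.sum_ite_eq', if_pos (Finset.mem_range.2 hm'),
    Finset.sum_range_succ, h.path i hi h0 l]
  by_cases e : g (Q i) = l
  · subst e
    rw [Function.update_self, if_pos rfl]
    ring
  · rw [Function.update_of_ne (Ne.symm e), if_neg e]
    ring

/-- Passes the weight of one vertex to its parent and its label. -/
def accumulateBody : Prog :=
  seq (setWord 2 (.sub (.var 2) (.const 1))) <|
  seq (setWord 4 (.get 2 (.var 2))) <|
  seq (setWord 9 (.get 4 (.var 4))) <|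
  seq (setWord 11 (.get 5 (.var 4))) <|
  seq (putReal 1 (.var 9) (.add (.get 1 (.var 9)) (.get 0 (.var 4)))) <|
  putReal 0 (.var 11) (.add (.get 0 (.var 11)) (.get 0 (.var 4)))

/-- Sums up the weights of the halfspaces, along the queue in reverse order. -/
def accumulateProg : Prog :=
  seq (setWord 2 (.var 0)) <|
  -- The root, at position 0, has no parent and is left out; its remaining term vanishes because no
  -- label separates it from itself.
  loop (.wordLt (.const 1) (.var 2)) accumulateBody

theorem accumulateProg_runs {B n r : ℕ} {off adj Q g f : ℕ → ℕ} {χ : ℕ → ℕ → ℝ}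
    (hT : IsTree n r Q g f χ) (hn0 : 0 < n) (hB : n + 2 ≤ B) {s : State}
    (hs : HoldsLists n off adj s) (hr : s.word 8 = r) (hQ : s.wordArr 2 = Q)
    (hg : s.wordArr 4 = g) (hf : s.wordArr 5 = f) (hP : ∀ x < n, s.realArr 1 x = 0) :
    Runs B accumulateProg s (40 * (n + 1)) fun s' => HoldsLists n off adj s' ∧
      s'.real = s.real ∧ s'.word 8 = r ∧ s'.wordArr 2 = Q ∧ s'.wordArr 4 = g ∧ s'.wordArr 5 = f ∧
      ∀ l < n, s'.realArr 1 l = ∑ m ∈ Finset.range n, s.realArr 0 (Q m) * χ l (Q m) := by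
  set Inv : ℕ → State → Prop := fun k s' => HoldsLists n off adj s' ∧
      s'.real = s.real ∧ s'.word 8 = r ∧ s'.wordArr 2 = Q ∧ s'.wordArr 4 = g ∧ s'.wordArr 5 = f ∧
      s'.word 2 = n - k ∧
      ∀ l < n, s'.realArr 1 l + ∑ m ∈ Finset.range (n - k), s'.realArr 0 (Q m) * χ l (Q m) =
        ∑ m ∈ Finset.range n, s.realArr 0 (Q m) * χ l (Q m) with hInv
  have h0 : Runs B (setWord 2 (.var 0)) s 2 (Inv 0) := by
    obtain ⟨hn, ho, ha⟩ := hs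
    refine Runs.straight ?_ (by decide) ?_
    · simp [hn]
      omega
    · simp [hInv, HoldsLists, hn, ho, ha, hr, hQ, hg, hf]
      exact hP
  refine (h0.seq fun s' hs' => Runs.loop (K := 30) (m := 0) (M := n - 1) (Nat.zero_le _) ?_ ?_
    hs').mono ?_ fun s' hs' => ?_
  · rintro k s hk ⟨-, -, -, -, -, -, h2, -⟩
    simp [h2]
    omega
  · rintro k s - hk ⟨⟨hn, ho, ha⟩, hρ, hr, hQ, hg, hf, h2, hsum⟩
    obtain ⟨i, hi⟩ : ∃ i, n - k = i + 1 := ⟨n - k - 1, by omega⟩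
    have hi' : n - (k + 1) = i := by omega
    rw [hi] at h2 hsum
    have hin : i < n := by omega
    have hi0 : 0 < i := by omega
    have hvn := hT.lt i hin
    have hgn := hT.label_lt i hin
    obtain ⟨m, hm, hfm⟩ := hT.parent i hin hi0
    have hfn : f (Q i) < n := by rw [hfm]; exact hT.lt m (by omega)
    refine Runs.straight ?_ (by decide) ?_
    · simp [accumulateBody, h2, hQ, hg, hf]
      omega
    · simp [accumulateBody, hInv, HoldsLists, h2, hn, ho, ha, hr, hρ, hQ, hg, hf, hi']
      intro l hl
      rw [hT.push_weight hin hi0]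
      exact hsum l hl
  · simp only [Test.cost, WExp.cost]
    omega
  · obtain ⟨h1, h2, h3, h4, h5, h6, -, h7⟩ := hs'
    refine ⟨h1, h2, h3, h4, h5, h6, fun l hl => ?_⟩
    have h8 := h7 l hl
    have h9 : n - (n - 1) = 0 + 1 := by omega
    rw [h9, Finset.sum_range_succ, Finset.sum_range_zero, hT.zero, hT.root, mul_zero, add_zero,
      add_zero] at h8
    exact h8

/-- Among the first `i` values of `Φ` along `Q`, the first minimum is at `lo` and the last one at
`hi`. -/
def Selected (Φ : ℕ → ℝ) (Q : ℕ → ℕ) (i lo hi : ℕ) (best : ℝ) : Prop :=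
  (∀ k < i, best ≤ Φ (Q k)) ∧
  (∃ a < i, lo = Q a ∧ Φ (Q a) = best ∧ ∀ k < a, best < Φ (Q k)) ∧
  ∃ b < i, hi = Q b ∧ Φ (Q b) = best ∧ ∀ k < i, b < k → best < Φ (Q k)

theorem Selected.succ {Φ : ℕ → ℝ} {Q : ℕ → ℕ} {i lo hi : ℕ} {best : ℝ}
    (h : Selected Φ Q i lo hi best) :
    (Φ (Q i) < best → Selected Φ Q (i + 1) (Q i) (Q i) (Φ (Q i))) ∧
    (best < Φ (Q i) → Selected Φ Q (i + 1) lo hi best) ∧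
    (Φ (Q i) = best → Selected Φ Q (i + 1) lo (Q i) best) := by
  obtain ⟨h1, ⟨a, ha, ea, h2, h3⟩, b, hb, eb, h4, h5⟩ := h
  have hall : ∀ {p : ℕ → Prop}, (∀ k < i, p k) → p i → ∀ k < i + 1, p k := by
    intro p hp hi k hk
    rcases Nat.lt_succ_iff_lt_or_eq.1 hk with h | rfl
    · exact hp k h
    · exact hi
  refine ⟨fun hlt => ⟨?_, ⟨i, by omega, rfl, rfl, fun k hk => hlt.trans_le (h1 k hk)⟩,
      i, by omega, rfl, rfl, fun k hk hk' => by omega⟩,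
    fun hlt => ⟨?_, ⟨a, by omega, ea, h2, h3⟩, b, by omega, eb, h4, ?_⟩,
    fun heq => ⟨?_, ⟨a, by omega, ea, h2, h3⟩, i, by omega, rfl, heq, fun k hk hk' => by omega⟩⟩
  · exact hall (fun k hk => hlt.le.trans (h1 k hk)) le_rfl
  · exact hall h1 hlt.le
  · exact hall h5 fun _ => hlt
  · exact hall h1 heq.ge

/-- Computes the median function at one vertex. -/
def selectBody : Prog :=
  seq (setWord 4 (.get 2 (.var 2))) <|
  seq (putReal 2 (.var 4) (.add (.get 2 (.get 5 (.var 4)))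
    (.sub (.var 0) (.add (.get 1 (.get 4 (.var 4))) (.get 1 (.get 4 (.var 4))))))) <|
  seq (branch (.realLt (.get 2 (.var 4)) (.var 1))
    (seq (setReal 1 (.get 2 (.var 4))) <| seq (setWord 9 (.var 4)) (setWord 10 (.var 4)))
    -- A tie moves only the last minimum.
    (branch (.realLt (.var 1) (.get 2 (.var 4))) skip (setWord 10 (.var 4)))) <|
  setWord 2 (.add (.var 2) (.const 1))

/-- Computes the median function up to a constant, and its first and last minimum along the
queue. -/
def selectProg : Prog :=
  seq (seq (putReal 2 (.var 8) .zero) <| seq (setReal 1 .zero) <| seq (setWord 9 (.var 8)) <|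
    seq (setWord 10 (.var 8)) (setWord 2 (.const 1))) <|
  seq (loop (.wordLt (.var 2) (.var 0)) selectBody) <|
  -- The size in variable 0 is needed by the loop test, so the output overwrites it only now.
  seq (setWord 0 (.var 9)) (setWord 1 (.var 10))

theorem selectProg_runs {B n r : ℕ} {off adj Q g f : ℕ → ℕ} {χ : ℕ → ℕ → ℝ} {Φ : ℕ → ℝ}
    (hT : IsTree n r Q g f χ) (hn0 : 0 < n) (hB : n + 2 ≤ B) {s : State}
    (hs : HoldsLists n off adj s) (hr : s.word 8 = r) (hQ : s.wordArr 2 = Q)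
    (hg : s.wordArr 4 = g) (hf : s.wordArr 5 = f) (hΦr : Φ r = 0)
    (hΦ : ∀ k < n, 0 < k → Φ (Q k) = Φ (f (Q k)) +
      (s.real 0 - (s.realArr 1 (g (Q k)) + s.realArr 1 (g (Q k))))) :
    Runs B selectProg s (60 * (n + 1)) fun s' =>
      ∃ best, Selected Φ Q n (s'.word 0) (s'.word 1) best := by
  set Inv : ℕ → State → Prop := fun i s' => HoldsLists n off adj s' ∧
      s'.real 0 = s.real 0 ∧ s'.realArr 1 = s.realArr 1 ∧ s'.wordArr 2 = Q ∧ s'.wordArr 4 = g ∧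
      s'.wordArr 5 = f ∧ s'.word 2 = i ∧ (∀ k < i, s'.realArr 2 (Q k) = Φ (Q k)) ∧
      Selected Φ Q i (s'.word 9) (s'.word 10) (s'.real 1) with hInv
  have hrn : r < n := by rw [← hT.zero]; exact hT.lt 0 hn0
  have h0 : Runs B (seq (putReal 2 (.var 8) .zero) <| seq (setReal 1 .zero) <|
      seq (setWord 9 (.var 8)) <| seq (setWord 10 (.var 8)) (setWord 2 (.const 1))) s 12
      (Inv 1) := by
    obtain ⟨hn, ho, ha⟩ := hs
    refine Runs.straight ?_ (by decide) ?_
    · simp [hr]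
      omega
    · simp [hInv, HoldsLists, hn, ho, ha, hr, hQ, hg, hf, hT.zero, hΦr]
      refine ⟨fun k hk => ?_, ⟨0, by omega, hT.zero.symm, by rw [hT.zero, hΦr],
        fun k hk => by omega⟩, 0, by omega, hT.zero.symm, by rw [hT.zero, hΦr],
        fun k hk hk' => by omega⟩
      have : k = 0 := by omega
      rw [this, hT.zero, hΦr]
  refine (h0.seq fun s' hs' => (Runs.loop (K := 50) (m := 1) (M := n) hn0 ?_ ?_
    hs').seq (T' := 4) fun s'' hs'' => ?_).mono ?_ fun s' hs' => hs'
  · rintro i s hi ⟨⟨hn, _⟩, _, _, _, _, _, h2, _⟩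
    simp [h2, hn]
    omega
  · rintro i s' hi hi' ⟨⟨hn, ho, ha⟩, hρ, hP, hQ, hg, hf, h2, hF, hS⟩
    have hvn := hT.lt i hi'
    have hgn := hT.label_lt i hi'
    obtain ⟨m, hm, hfm⟩ := hT.parent i hi' hi
    have hfn : f (Q i) < n := by rw [hfm]; exact hT.lt m (by omega)
    have hval : s'.realArr 2 (f (Q i)) + (s.real 0 - (s.realArr 1 (g (Q i)) +
        s.realArr 1 (g (Q i)))) = Φ (Q i) := by
      rw [hΦ i hi' hi, hfm, hF m hm]
    have hF' : ∀ k ≤ i, Function.update (s'.realArr 2) (Q i) (Φ (Q i)) (Q k) = Φ (Q k) := by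
      intro k hk
      rcases hk.lt_or_eq with h | rfl
      · rw [Function.update_of_ne, hF k h]
        intro e
        have := hT.inj k (by omega) i hi' e
        omega
      · rw [Function.update_self]
    obtain ⟨s1, s2, s3⟩ := hS.succ
    by_cases hc1 : Φ (Q i) < s'.real 1
    · refine Runs.straight ?_ (by decide) ?_
      · simp [selectBody, h2, hQ, hg, hf, hP, hρ, hval, hc1]
        omega
      · simp [selectBody, hInv, HoldsLists, h2, hn, ho, ha, hQ, hg, hf, hP, hρ, hval, hc1]
        exact ⟨hF', s1 hc1⟩
    · by_cases hc2 : s'.real 1 < Φ (Q i)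
      · refine Runs.straight ?_ (by decide) ?_
        · simp [selectBody, h2, hQ, hg, hf, hP, hρ, hval, hc1, hc2]
          omega
        · simp [selectBody, hInv, HoldsLists, h2, hn, ho, ha, hQ, hg, hf, hP, hρ, hval, hc1, hc2]
          exact ⟨hF', s2 hc2⟩
      · refine Runs.straight ?_ (by decide) ?_
        · simp [selectBody, h2, hQ, hg, hf, hP, hρ, hval, hc1, hc2]
          omega
        · simp [selectBody, hInv, HoldsLists, h2, hn, ho, ha, hQ, hg, hf, hP, hρ, hval, hc1, hc2]
          exact ⟨hF', s3 (le_antisymm (not_lt.1 hc2) (not_lt.1 hc1))⟩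
  · obtain ⟨-, -, -, -, -, -, -, -, hS⟩ := hs''
    have hle : s''.word 9 < n ∧ s''.word 10 < n := by
      obtain ⟨-, ⟨a, ha, e, -⟩, b, hb, e', -⟩ := hS
      rw [e, e']
      exact ⟨hT.lt a ha, hT.lt b hb⟩
    refine Runs.straight ?_ (by decide) ?_
    · simp
      omega
    · simp
      exact ⟨_, hS⟩
  · simp only [Test.cost, WExp.cost]
    omega

end Select

/-! ### From memory contents to the graph, and assembly of the phases -/

section Correctness

/-- The vertex with number `x`; the root, if there is none. -/
def toVertex {n : ℕ} (r : Fin n) (x : ℕ) : Fin n :=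
  if h : x < n then ⟨x, h⟩ else r

@[simp] theorem toVertex_val {n : ℕ} (r v : Fin n) : toVertex r (v : ℕ) = v := by
  simp [toVertex]

theorem val_toVertex {n : ℕ} (r : Fin n) {x : ℕ} (h : x < n) : (toVertex r x : ℕ) = x := by
  simp [toVertex, h]

variable {n : ℕ} {G : SimpleGraph (Fin n)} {w : Fin n → ℝ} {s : State}

theorem HoldsInput.listed_iff (h : HoldsInput G w s) (v : Fin n) (u : ℕ) :
    Listed (s.wordArr 0) (s.wordArr 1) v u ↔ ∃ u' : Fin n, G.Adj v u' ∧ (u' : ℕ) = u := by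
  have h1 := (h.lists v).image_eq
  have h2 : u ∈ s.wordArr 1 '' Set.Ico (s.wordArr 0 v) (s.wordArr 0 (v + 1)) ↔
      ∃ u' : Fin n, G.Adj v u' ∧ (u' : ℕ) = u := by
    rw [h1]
    rfl
  rw [← h2]
  simp only [Listed, Set.mem_image, Set.mem_Ico, and_assoc]

theorem HoldsInput.adj_iff (h : HoldsInput G w s) (r : Fin n) {v u : ℕ} (hv : v < n)
    (hu : u < n) : Listed (s.wordArr 0) (s.wordArr 1) v u ↔
      G.Adj (toVertex r v) (toVertex r u) := by
  have h1 := h.listed_iff (toVertex r v) u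
  rw [val_toVertex r hv] at h1
  rw [h1]
  constructor
  · rintro ⟨u', h2, rfl⟩
    simpa using h2
  · exact fun h2 => ⟨_, h2, val_toVertex r hu⟩

theorem HoldsInput.sum_degree (h : HoldsInput G w s) [DecidableRel G.Adj] :
    s.wordArr 0 n = ∑ v, G.degree v := by
  have h1 : ∀ m ≤ n, ∑ x ∈ Finset.range m, (s.wordArr 0 (x + 1) - s.wordArr 0 x) =
      s.wordArr 0 m := by
    intro m
    induction m with
    | zero => simp [h.off_zero]
    | succ m ih =>
      intro hm
      rw [Finset.sum_range_succ, ih (by omega)]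
      have : s.wordArr 0 m ≤ s.wordArr 0 (m + 1) := h.off_le ⟨m, hm⟩
      omega
  rw [← h1 n le_rfl, Finset.sum_range]
  refine Finset.sum_congr rfl fun v _ => ?_
  have h2 := h.lists v
  have h3 : (s.wordArr 1 '' Set.Ico (s.wordArr 0 v) (s.wordArr 0 (v + 1))).ncard =
      ((fun u : Fin n => (u : ℕ)) '' G.neighborSet v).ncard := by rw [h2.image_eq]
  rw [h2.injOn.ncard_image, Set.ncard_image_of_injective _ Fin.val_injective,
    Set.ncard_eq_toFinset_card', Set.toFinset_Ico, Nat.card_Ico, Set.ncard_eq_toFinset_card',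
    Set.toFinset_card, SimpleGraph.card_neighborSet_eq_degree] at h3
  exact h3

theorem HoldsInput.off_eq (h : HoldsInput G w s) : s.wordArr 0 n = 2 * G.edgeSet.ncard := by
  classical
  rw [h.sum_degree, G.sum_degrees_eq_twice_card_edges, Set.ncard_eq_toFinset_card',
    SimpleGraph.edgeFinset]

theorem HoldsInput.off_le_sq (h : HoldsInput G w s) : s.wordArr 0 n ≤ n * n := by
  classical
  rw [h.sum_degree]
  refine (Finset.sum_le_card_nsmul _ _ n fun v _ => ?_).trans (by simp)
  simpa using (G.degree_lt_card_verts v).le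

/-- The largest numbers handled are list positions, at most `n * n`. -/
theorem HoldsInput.off_fits (h : HoldsInput G w s) {c : ℕ} (hc : 2 ≤ c) :
    n + 2 ≤ (n + 2) ^ c ∧ s.wordArr 0 n + 2 ≤ (n + 2) ^ c := by
  have h1 : (n + 2) ^ 2 ≤ (n + 2) ^ c := Nat.pow_le_pow_right (by omega) hc
  have h2 := h.off_le_sq
  exact ⟨le_trans (by nlinarith) h1, le_trans (by nlinarith) h1⟩

theorem dist_lt_card {V : Type*} [Fintype V] {G : SimpleGraph V} (hG : G.Connected) (x y : V) :
    G.dist x y < Fintype.card V := by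
  obtain ⟨p, hp, hl⟩ := hG.exists_path_of_dist x y
  rw [← hl]
  exact hp.length_lt

theorem HoldsInput.rooted (h : HoldsInput G w s) (hG : IsMedian G) (r : Fin n) :
    Rooted n (s.wordArr 0) (s.wordArr 1) r fun x => G.dist r (toVertex r x) := by
  have hlt : ∀ v < n, ∀ u, Listed (s.wordArr 0) (s.wordArr 1) v u → u < n := by
    intro v hv u hu
    obtain ⟨u', -, rfl⟩ := (h.listed_iff ⟨v, hv⟩ u).1 hu
    exact u'.2
  refine ⟨r.2, h.off_zero, fun v hv => h.off_le ⟨v, hv⟩, hlt, ?_, by simp, ?_, ?_, ?_⟩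
  · intro v hv u hu
    have hun := hlt v hv u hu
    exact (h.adj_iff r hun hv).2 ((h.adj_iff r hv hun).1 hu).symm
  · intro x _
    simpa using dist_lt_card hG.1 r (toVertex r x)
  · intro v hv u hu
    have := hG.dist_adj ((h.adj_iff r hv (hlt v hv u hu)).1 hu) r
    omega
  · intro x hx hxr
    have hne : toVertex r x ≠ r := fun e => hxr (by rw [← val_toVertex r hx, e])
    obtain ⟨y, hy, hd⟩ := exists_down hG hne
    refine ⟨y, y.2, (h.adj_iff r y.2 hx).2 ?_, ?_⟩
    · simpa using hy.symm
    · simpa using hd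

/-- The position of a vertex in the queue. -/
noncomputable def position (Q : ℕ → ℕ) (x : Fin n) : ℕ :=
  sInf {k | Q k = x}

section Positions

variable {r : Fin n} {Q : ℕ → ℕ}

theorem Ordered.position_eq (h : Ordered n r (fun x => G.dist r (toVertex r x)) Q) {k : ℕ}
    (hk : k < n) {x : Fin n} (e : Q k = x) : position Q x = k := by
  have h1 : position Q x ≤ k := Nat.sInf_le e
  have h2 : Q (position Q x) = x := Nat.sInf_mem (s := {k | Q k = x}) ⟨k, e⟩
  exact h.inj _ (by omega) _ hk (h2.trans e.symm)

theorem Ordered.position_spec (h : Ordered n r (fun x => G.dist r (toVertex r x)) Q)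
    (x : Fin n) : position Q x < n ∧ Q (position Q x) = x := by
  obtain ⟨k, hk, e⟩ := h.surj x x.2
  rw [h.position_eq hk e]
  exact ⟨hk, e⟩

theorem Ordered.isLayered (h : Ordered n r (fun x => G.dist r (toVertex r x)) Q) :
    IsLayered G r (position Q) := by
  refine ⟨fun x y e => ?_, ?_, fun x y hlt => ?_⟩
  · apply Fin.ext
    rw [← (h.position_spec x).2, ← (h.position_spec y).2, e]
  · exact h.position_eq (Nat.zero_lt_of_lt r.2) h.zero
  · by_contra hcon
    have h1 := h.mono _ _ (not_lt.1 hcon) (h.position_spec x).1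
    rw [(h.position_spec x).2, (h.position_spec y).2] at h1
    simp only [toVertex_val] at h1
    omega

/-- The parent of `v` is `f`, and `k` is the label of the halfspace across this edge, which is
the largest label of a halfspace that separates `v` from the root. -/
def GoodLabel (G : SimpleGraph (Fin n)) (r : Fin n) (Q : ℕ → ℕ) (v k f : ℕ) : Prop :=
  (v = r ∧ k = 0) ∨ (v < n ∧ f < n ∧ IsTop G r (position Q) (toVertex r v) (toVertex r f) ∧
    k = label (position Q) (half G (toVertex r v) (toVertex r f)))

/-- Translates `isTop_of_lt` and `isTop_of_eq` to vertex numbers: the two outcomes of the comparison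
of minimum and maximum. -/
theorem HoldsInput.labelling (hs : HoldsInput G w s) (hG : IsMedian G)
    (h : Ordered n r (fun x => G.dist r (toVertex r x)) Q) :
    Labelling n (s.wordArr 0) (s.wordArr 1) r (fun x => G.dist r (toVertex r x)) Q
      (GoodLabel G r Q) := by
  have hpos := h.isLayered
  have hR := hs.rooted hG r
  refine ⟨fun x => Or.inl ⟨rfl, rfl⟩, ?_, ?_⟩
  · rintro v hv k f (⟨-, rfl⟩ | ⟨-, -, ht, rfl⟩)
    · omega
    · exact (label_le (hG.half_left ht.1.1)).trans_lt (h.position_spec _).1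
  · intro i hi hir g f k hg hf hdf hbd
    have hvn := h.lt i hi
    have hfn := hR.listed_lt _ hvn f hf
    have hdown : ∀ u, u < n → (Listed (s.wordArr 0) (s.wordArr 1) (Q i) u ∧
        G.dist r (toVertex r u) < G.dist r (toVertex r (Q i)) ↔
        Down G r (toVertex r (Q i)) (toVertex r u)) := by
      intro u hu
      rw [hs.adj_iff r hvn hu]
      constructor
      · rintro ⟨h1, h2⟩
        have := hG.dist_adj h1 r
        exact ⟨h1, by omega⟩
      · rintro ⟨h1, h2⟩
        exact ⟨h1, by omega⟩
    have hdown' : ∀ u : Fin n, Down G r (toVertex r (Q i)) u →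
        Listed (s.wordArr 0) (s.wordArr 1) (Q i) u ∧
        G.dist r (toVertex r u) < G.dist r (toVertex r (Q i)) := by
      intro u hu
      exact (hdown u u.2).2 (by simpa using hu)
    have hposi : position Q (toVertex r (Q i)) = i := h.position_eq hi (val_toVertex r hvn).symm
    have hlab : ∀ u, Down G r (toVertex r (Q i)) u →
        IsTopLabel G r (position Q) u ((fun u : Fin n => g u) u) := by
      intro u hu
      obtain ⟨h1, h2⟩ := hdown' u hu
      obtain ⟨f', ⟨h3, h4⟩ | ⟨-, -, h3, h4⟩⟩ := hg u h1 h2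
      · exact Or.inl ⟨Fin.ext h3, h4⟩
      · simp only [toVertex_val] at h3 h4
        exact Or.inr ⟨_, h3, h4⟩
    have hfd : Down G r (toVertex r (Q i)) (toVertex r f) := (hdown f hfn).1 ⟨hf, hdf⟩
    have hgf : g (toVertex r f : ℕ) = g f := by rw [val_toVertex r hfn]
    constructor
    · rintro hlt ⟨u, hu, hdu, rfl⟩
      have hun := hR.listed_lt _ hvn u hu
      obtain ⟨h1, h2⟩ := isTop_of_lt hG hpos (g := fun u : Fin n => g u) hlab (k := g u) hfd
        (fun u' hu' => by
          rw [hgf]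
          exact (hbd u' (hdown' u' hu').1 (hdown' u' hu').2).1)
        (fun u' hu' => (hbd u' (hdown' u' hu').1 (hdown' u' hu').2).2)
        ⟨toVertex r u, (hdown u hun).1 ⟨hu, hdu⟩, by rw [val_toVertex r hun]⟩
        (by rw [hgf]; exact hlt)
      exact Or.inr ⟨hvn, hfn, h1, h2⟩
    · intro hlt
      obtain ⟨h1, h2⟩ := isTop_of_eq hG hpos (g := fun u : Fin n => g u) hlab hfd
        (fun u' hu' => by
          rw [hgf]
          have h3 := hbd u' (hdown' u' hu').1 (hdown' u' hu').2
          omega)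
      exact Or.inr ⟨hvn, hfn, h1, hposi.symm.trans h2⟩

variable {g f : ℕ → ℕ}

theorem Ordered.goodLabel_of_pos (h : Ordered n r (fun x => G.dist r (toVertex r x)) Q)
    (hgood : ∀ x < n, GoodLabel G r Q x (g x) (f x)) {k : ℕ} (hk : k < n) (hk0 : 0 < k) :
    f (Q k) < n ∧ IsTop G r (position Q) (toVertex r (Q k)) (toVertex r (f (Q k))) ∧
    g (Q k) = label (position Q) (half G (toVertex r (Q k)) (toVertex r (f (Q k)))) := by
  rcases hgood (Q k) (h.lt k hk) with ⟨h1, -⟩ | ⟨-, h1⟩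
  · have := h.inj k hk 0 (by omega) (h1.trans h.zero.symm)
    omega
  · exact h1

/-- The indicator is separation from the root, and its path equation is `sep_eq_add` along the edge
to the parent. -/
theorem Ordered.isTree (h : Ordered n r (fun x => G.dist r (toVertex r x)) Q)
    (hG : IsMedian G) (hL : ∀ v < n, ∀ k f, GoodLabel G r Q v k f → k < n)
    (hgood : ∀ x < n, GoodLabel G r Q x (g x) (f x)) :
    IsTree n r Q g f fun l x => sep G r (position Q) l (toVertex r x) := by
  refine ⟨h.lt, h.inj, h.zero, fun k hk => hL _ (h.lt k hk) _ _ (hgood _ (h.lt k hk)), ?_, ?_, ?_⟩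
  · intro k hk hk0
    obtain ⟨h1, h2, -⟩ := h.goodLabel_of_pos hgood hk hk0
    obtain ⟨m, hm, e⟩ := h.surj _ h1
    refine ⟨m, ?_, e.symm⟩
    by_contra hcon
    have h3 := h.mono k m (not_lt.1 hcon) hm
    have h4 := h2.1.2
    rw [e] at h3
    omega
  · intro l
    simp [sep_root]
  · intro k hk hk0 l
    obtain ⟨h1, h2, h3⟩ := h.goodLabel_of_pos hgood hk hk0
    rw [sep_eq_add hG h.isLayered h2.1, h3]

theorem Ordered.medianFn_step (h : Ordered n r (fun x => G.dist r (toVertex r x)) Q)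
    (hG : IsMedian G) (hgood : ∀ x < n, GoodLabel G r Q x (g x) (f x)) {W : ℕ → ℝ}
    (hW : ∀ v : Fin n, W v = w v) {k : ℕ} (hk : k < n) (hk0 : 0 < k) :
    medianFn G w (toVertex r (Q k)) = medianFn G w (toVertex r (f (Q k))) +
      (∑ x ∈ Finset.range n, W x - 2 * ∑ m ∈ Finset.range n, W (Q m) *
        sep G r (position Q) (g (Q k)) (toVertex r (Q m))) := by
  obtain ⟨h1, h2, h3⟩ := h.goodLabel_of_pos hgood hk hk0
  rw [h.sum_eq fun x => W x * sep G r (position Q) (g (Q k)) (toVertex r x), Finset.sum_range,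
    Finset.sum_range, h3]
  have h4 := medianFn_adj (w := w) hG h2.1.1
  rw [weight_half_eq_sum_sep w hG h.isLayered h2.1] at h4
  simp only [hW, toVertex_val]
  linarith

theorem Ordered.first_last (h : Ordered n r (fun x => G.dist r (toVertex r x)) Q)
    (hG : IsMedian G) (hw : ∀ x, 0 ≤ w x) (hr : 0 < w r) {lo hi : ℕ} {best : ℝ}
    (hS : Selected (fun x => medianFn G w (toVertex r x) - medianFn G w r) Q n lo hi best) :
    ∃ u v : Fin n, lo = u ∧ hi = v ∧ medianSet G w = interval G u v ∧ u ∈ medianSet G w ∧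
      0 < weight w (fiber G (medianSet G w) u) ∧ IsFarthest G (medianSet G w) u v := by
  obtain ⟨h1, ⟨a, ha, rfl, h2, h3⟩, b, hb, rfl, h4, h5⟩ := hS
  beta_reduce at h1 h2 h3 h4 h5
  have hval : ∀ z : Fin n, medianFn G w (toVertex r (Q (position Q z))) = medianFn G w z := by
    intro z
    rw [(h.position_spec z).2, toVertex_val]
  have hmin : ∀ z : Fin n, best ≤ medianFn G w z - medianFn G w r := by
    intro z
    have := h1 _ (h.position_spec z).1
    rwa [hval] at this
  have hmed : ∀ c, medianFn G w (toVertex r (Q c)) - medianFn G w r = best →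
      toVertex r (Q c) ∈ medianSet G w := by
    intro c hc z
    have := hmin z
    linarith
  have hpa : position Q (toVertex r (Q a)) = a :=
    h.position_eq ha (val_toVertex r (h.lt a ha)).symm
  have hpb : position Q (toVertex r (Q b)) = b :=
    h.position_eq hb (val_toVertex r (h.lt b hb)).symm
  have hu := hmed a h2
  have hv := hmed b h4
  obtain ⟨h6, h7⟩ := first_last_medianSet hG hw hr h.isLayered hu hv
    (fun z hz => by
      rw [hpa]
      by_contra hcon
      have h6 := h3 _ (not_le.1 hcon)
      rw [hval] at h6
      have := hz (toVertex r (Q a))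
      linarith)
    (fun z hz => by
      rw [hpb]
      by_contra hcon
      have h6 := h5 _ (h.position_spec z).1 (not_le.1 hcon)
      rw [hval] at h6
      have := hz (toVertex r (Q b))
      linarith)
  exact ⟨_, _, (val_toVertex r (h.lt a ha)).symm, (val_toVertex r (h.lt b hb)).symm,
    medianSet_eq_interval hG hw hu h6 h7, hu, h6, h7⟩

end Positions

/-- Computes two vertices that span the median set. -/
def medianProg : Prog :=
  .seq initProg <| .seq searchProg <| .seq labelProg <| .seq accumulateProg selectProg

theorem medianProg_runs {B : ℕ} (hG : IsMedian G) (hw : ∀ x, 0 ≤ w x) (hpos : 0 < ∑ x, w x)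
    (hs : HoldsInput G w s) (hB : n + 2 ≤ B) (hB' : s.wordArr 0 n + 2 ≤ B) :
    Runs B medianProg s (800 * (G.edgeSet.ncard + 1)) fun s' => ∃ u v : Fin n,
      s'.word 0 = u ∧ s'.word 1 = v ∧ medianSet G w = interval G u v ∧ u ∈ medianSet G w ∧
      0 < weight w (fiber G (medianSet G w) u) ∧ IsFarthest G (medianSet G w) u v := by
  have hex : ∃ x < n, 0 < s.realArr 0 x := by
    by_contra! hcon
    refine absurd hpos (not_lt.2 (Finset.sum_nonpos fun x _ => ?_))
    rw [← hs.weights]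
    exact hcon x x.2
  have hlists : HoldsLists n (s.wordArr 0) (s.wordArr 1) s := ⟨hs.size, rfl, rfl⟩
  have hcard : n ≤ G.edgeSet.ncard + 1 := by
    have := hG.1.card_vert_le_card_edgeSet_add_one
    rwa [Nat.card_fin] at this
  have hoff := hs.off_eq
  -- With n ≤ m + 1 and lists of total length 2m, the sum of the phase bounds is at most 710m + 660.
  refine ((initProg_runs hB hlists rfl hex).seq fun s₁ h₁ => ?_).mono
    (T := 40 * (n + 1) + (80 * (n + s.wordArr 0 n + 1) + (110 * (n + s.wordArr 0 n + 1) +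
      (40 * (n + 1) + 60 * (n + 1))))) (by omega) fun _ h => h
  obtain ⟨l₁, hW₁, hD₁, hP₁, htot₁, hr₁, hwr⟩ := h₁
  obtain ⟨r, hr⟩ : ∃ r : Fin n, s₁.word 8 = r := ⟨⟨_, hr₁⟩, rfl⟩
  have hwr' : 0 < w r := by rw [← hs.weights r, ← hr]; exact hwr
  have hR := hs.rooted hG r
  refine (searchProg_runs hR hB hB' l₁ hr hD₁).seq fun s₂ h₂ => ?_
  obtain ⟨l₂, hρ₂, hρA₂, hr₂, hO, hD₂⟩ := h₂
  have hL := hs.labelling hG hO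
  refine (labelProg_runs hR hO hL hB hB' l₂ hr₂ rfl hD₂).seq fun s₃ h₃ => ?_
  obtain ⟨l₃, hρ₃, hρA₃, hr₃, hQ₃, hgood⟩ := h₃
  have hgood' := fun x hx => (hgood x hx).1
  have hT := hO.isTree hG hL.lt hgood'
  have hn0 : 0 < n := Nat.zero_lt_of_lt r.2
  refine (accumulateProg_runs hT hn0 hB l₃ hr₃ hQ₃ rfl rfl fun x hx => ?_).seq fun s₄ h₄ => ?_
  · rw [hρA₃, hρA₂]
    exact hP₁ x hx
  obtain ⟨l₄, hρ₄, hr₄, hQ₄, hg₄, hf₄, hP₄⟩ := h₄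
  refine (selectProg_runs (Φ := fun x => medianFn G w (toVertex r x) - medianFn G w r) hT hn0 hB
    l₄ hr₄ hQ₄ hg₄ hf₄ (by simp) fun k hk hk0 => ?_).mono le_rfl ?_
  · have h1 := hO.medianFn_step hG hgood' hs.weights hk hk0
    rw [hP₄ _ (hT.label_lt k hk), hρA₃, hρA₂, hW₁, hρ₄, hρ₃, hρ₂, htot₁]
    linarith
  · rintro s' ⟨best, hS⟩
    exact hO.first_last hG hw hwr' hS

end Correctness

end MedianGraph

theorem corollary5p3 :
    -- a uniform linear-time algorithm, on words of `O(log n)` bits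
    (∃ (p : MedianGraph.Prog) (c : ℕ),
      ∀ (n : ℕ) (G : SimpleGraph (Fin n)) (w : Fin n → ℝ) (s : MedianGraph.State),
        MedianGraph.IsMedian G → (∀ x, 0 ≤ w x) → 0 < ∑ x, w x →
        MedianGraph.HoldsInput G w s →
        ∃ (t : ℕ) (s' : MedianGraph.State) (u v : Fin n),
          MedianGraph.Exec ((n + 2) ^ c) p s t s' ∧
          t ≤ c * (G.edgeSet.ncard + 1) ∧
          s'.word 0 = (u : ℕ) ∧ s'.word 1 = (v : ℕ) ∧
          MedianGraph.medianSet G w = MedianGraph.interval G u v ∧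
          u ∈ MedianGraph.medianSet G w ∧
          0 < MedianGraph.weight w (MedianGraph.fiber G (MedianGraph.medianSet G w) u) ∧
          MedianGraph.IsFarthest G (MedianGraph.medianSet G w) u v) ∧
    -- any median vertex with a positive fiber, with any farthest vertex of the median set
    (∀ (V : Type*) [Fintype V] (G : SimpleGraph V) (w : V → ℝ),
      MedianGraph.IsMedian G → (∀ x, 0 ≤ w x) →
      ∀ u v : V, u ∈ MedianGraph.medianSet G w →
        0 < MedianGraph.weight w (MedianGraph.fiber G (MedianGraph.medianSet G w) u) →
        MedianGraph.IsFarthest G (MedianGraph.medianSet G w) u v →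
        MedianGraph.medianSet G w = MedianGraph.interval G u v) := by
  -- The constant 800 is dictated by the running time; as the exponent of the word size, 2 would
  -- suffice.
  refine ⟨⟨MedianGraph.medianProg, 800, fun n G w s hG hw hpos hs => ?_⟩,
    fun V _ G w hG hw u v hu hf hv => MedianGraph.medianSet_eq_interval hG hw hu hf hv⟩
  obtain ⟨h1, h2⟩ := hs.off_fits (c := 800) (by omega)
  obtain ⟨t, s', h3, h4, u, v, h5⟩ := MedianGraph.medianProg_runs hG hw hpos hs h1 h2
  exact ⟨t, s', u, v, h3, h4, h5⟩
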